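/- Let $d\ge 1$, let $\Theta\subset\mathbb R^d$ be compact and convex with non-empty interior, and let $\beta\ge 2$, $L>0$, $I_*>0$, $v_0>0$. Write $\ell$ for the greatest integer strictly smaller than $\beta$ and $\Theta'=\{x+y:\ x\in\Theta,\ \|y\|\le 1\}$. For $\alpha,M>0$ let $\mathcal F_{\beta,\alpha}(L)=\mathcal F_{\beta,\alpha}(L;M)$ be the class of functions $f:\mathbb R^d\to\mathbb R$ such that: (i) $f$ attains its minimum over $\Theta$; (ii) $f$ is $\ell$ times differentiable and $\big|f(x')-\sum_{|m|\le \ell}\frac1{m!}D^mf(x)(x'-x)^m\big|\le L\|x'-x\|^\beta$ for all $x,x'\in\mathbb R^d$; (iii) $f(y)\ge f(x)+\langle\nabla f(x),y-x\rangle+\frac\alpha2\|x-y\|^2$ for all $x,y\in\Theta$; (iv) $|f|\le M$ on $\Theta'$. Let $f^*=\min_\Theta f$ and $x^*=\arg\min_\Theta f$. Let $n\ge 1$ and observe $(x_i,y_i)$, $y_i=f(x_i)+\xi_i$, $i=1,\dots,n$, where $x_1,\dots,x_n$ are i.i.d. with a bounded Lebesgue density on $\mathbb R^d$, $\xi_1,\dots,\xi_n$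 are i.i.d. with a Lebesgue density $p_\xi$ on $\mathbb R$ such that $$\int\big(\sqrt{p_\xi(u)}-\sqrt{p_\xi(u+v)}\big)^2du\le I_*v^2\qquad\text{for all }|v|\le v_0,$$ and $(\xi_1,\dots,\xi_n)$ is independent of $(x_1,\dots,x_n)$. Let $\mathbf E_f$ be the corresponding expectation. Estimators are arbitrary measurable functions of the data, with values in $\mathbb R^d$ (estimators $\hat x_n$ of $x^*$, which need not lie in $\Theta$) or in $\mathbb R$ (estimators $T_n$ of $f^*$). Fix $M_0>0$ and $\kappa\in(0,1)$, and call $(\alpha,M)$ admissible if $\alpha>0$, $M\ge \max\big(M_0,\alpha(1+\operatorname{diam}\Theta)^2\big)$ and, in the case $\beta=2$, $\alpha\le 2\kappa L$. (a) Let $w:[0,\infty)\to[0,\infty)$ be non-decreasing with $w(0)=0$ and $w\not\equiv 0$. There are $c_1,c_1'>0$ and $n_0\in\mathbb N$, depending only on $\beta,L,d,\Theta,I_*,v_0,w,M_0,\kappa$, with $n_0=1$ if $w(t)>0$ for all $t>0$, such that for all $n\ge n_0$, $n \geq 1$, and all admissible $(\alpha,M)$, $$\inf_{\hat x_n}\sup_{f\in\mathcal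 F_{\beta,\alpha}(L)}\mathbf E_f\,w\Big(\max\big(\alpha n^{\frac{\beta-1}{2\beta+d}},n^{\frac1{2\beta+d}}\big)\|\hat x_n-x^*\|\Big)\ge c_1,\qquad \inf_{T_n}\sup_{f\in\mathcal F_{\beta,\alpha}(L)}\mathbf E_f\,w\big(n^{\frac{\beta}{2\beta+d}}|T_n-f^*|\big)\ge c_1'.$$ (b) There is $c_2>0$ depending only on $\beta,L,d,\Theta,I_*,v_0,M_0,\kappa$ such that for all $n\ge1$ and all admissible $(\alpha,M)$, $$\inf_{\hat x_n}\sup_{f\in\mathcal F_{\beta,\alpha}(L)}\mathbf E_f[f(\hat x_n)-f^*]\ge c_2\min\Big(\alpha^{-1}n^{-\frac{2(\beta-1)}{2\beta+d}},\ \alpha n^{-\frac{2}{2\beta+d}}\Big),$$ where the expectation is taken in $[-\infty,\infty]$ (positive part minus negative part, $-\infty$ if both are infinite). -/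

import Mathlib

open MeasureTheory ProbabilityTheory Set
open scoped ENNReal

universe u

/-- The space `ℝ^d` with its Euclidean norm. -/
abbrev Euc (d : ℕ) : Type := EuclideanSpace ℝ (Fin d)

/-- The greatest integer strictly less than `β` (used for `β ≥ 2`). -/
noncomputable def holderOrder (β : ℝ) : ℕ := ⌈β⌉₊ - 1

/-- The Taylor polynomial of `f` of degree `l` at `x`, evaluated at `x'`. The term of degree `k`
is `(1 / k!) D^k f(x)[x' - x, …, x' - x]`, which is the sum of
`(1 / m!) D^m f(x) (x' - x)^m` over the multi-indices `m` with `|m| = k`. -/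
noncomputable def taylorPoly {d : ℕ} (l : ℕ) (f : Euc d → ℝ) (x x' : Euc d) : ℝ :=
  ∑ k ∈ Finset.range (l + 1),
    ((k.factorial : ℝ))⁻¹ * iteratedFDeriv ℝ k f x (fun _ => x' - x)

/-- The Hölder class `𝓕_β(L)`: the function is `l` times differentiable on `ℝ^d`, where `l` is the
greatest integer strictly less than `β`, and its Taylor remainder of order `l` is at most
`L ‖x - x'‖ ^ β`. -/
structure IsHolder {d : ℕ} (β L : ℝ) (f : Euc d → ℝ) : Prop where
  differentiable : ∀ k < holderOrder β, Differentiable ℝ (iteratedFDeriv ℝ k f)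
  taylor : ∀ x x' : Euc d, |f x' - taylorPoly (holderOrder β) f x x'| ≤ L * ‖x' - x‖ ^ β

/-- `f` is `α`-strongly convex on `Θ` (first-order form). -/
def IsStronglyConvexOn {d : ℕ} (Θ : Set (Euc d)) (α : ℝ) (f : Euc d → ℝ) : Prop :=
  ∀ x ∈ Θ, ∀ y ∈ Θ,
    f x + inner ℝ (gradient f x) (y - x) + α / 2 * ‖x - y‖ ^ 2 ≤ f y

/-- The set `Θ' = {x + y : x ∈ Θ, ‖y‖ ≤ 1}`. -/
def unitEnlargement {d : ℕ} (Θ : Set (Euc d)) : Set (Euc d) :=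
  {z | ∃ x ∈ Θ, ∃ y : Euc d, ‖y‖ ≤ 1 ∧ z = x + y}

/-- The class `𝓕_{β,α}(L)` of regression functions, with the bound `M` on `Θ'` made explicit. -/
structure IsRegressionFunction {d : ℕ} (Θ : Set (Euc d)) (β α L M : ℝ) (f : Euc d → ℝ) :
    Prop where
  attains : ∃ x ∈ Θ, IsMinOn f Θ x
  holder : IsHolder β L f
  stronglyConvex : IsStronglyConvexOn Θ α f
  bounded : ∀ x ∈ unitEnlargement Θ, |f x| ≤ M

/-- The class `𝓕_{β,α}(L)` as a set of functions. -/
def regressionClass {d : ℕ} (Θ : Set (Euc d)) (β α L M : ℝ) : Set (Euc d → ℝ) :=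
  {f | IsRegressionFunction Θ β α L M f}

/-- The minimizer `x^*` of `f` on `Θ` (it exists and is unique for `f` in `𝓕_{β,α}(L)`). -/
noncomputable def minimizer {d : ℕ} (Θ : Set (Euc d)) (f : Euc d → ℝ) : Euc d :=
  Classical.epsilon (fun x => x ∈ Θ ∧ IsMinOn f Θ x)

/-- The minimum value `f^*` of `f` on `Θ` (it is attained for `f` in `𝓕_{β,α}(L)`). -/
noncomputable def minValue {d : ℕ} (Θ : Set (Euc d)) (f : Euc d → ℝ) : ℝ := sInf (f '' Θ)

/-- The design points `X i` are i.i.d. with a bounded Lebesgue density, the errors `ξ i` are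
i.i.d. with Lebesgue density `pξ`, and the errors are jointly independent of the design. -/
structure IsPassiveSample {d n : ℕ} {Ω : Type u} [MeasurableSpace Ω] (μ : Measure Ω)
    (X : Fin n → Ω → Euc d) (ξ : Fin n → Ω → ℝ) (pξ : ℝ → ℝ) : Prop where
  measurable_design : ∀ i, Measurable (X i)
  measurable_noise : ∀ i, Measurable (ξ i)
  indep_design : iIndepFun X μ
  design_density : ∃ p : Euc d → ℝ, Measurable p ∧ (∀ x, 0 ≤ p x) ∧ (∃ B : ℝ, ∀ x, p x ≤ B) ∧
    ∀ i, μ.map (X i) = volume.withDensity (fun x => ENNReal.ofReal (p x))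
  indep_noise : iIndepFun ξ μ
  measurable_noise_density : Measurable pξ
  noise_density_nonneg : ∀ u, 0 ≤ pξ u
  noise_density : ∀ i, μ.map (ξ i) = volume.withDensity (fun u => ENNReal.ofReal (pξ u))
  indep : IndepFun (fun ω i => X i ω) (fun ω i => ξ i ω) μ

/-- The Hellinger regularity condition on a noise density, with constants `I` and `v₀`. -/
def HellingerRegular (I v₀ : ℝ) (pξ : ℝ → ℝ) : Prop :=
  ∀ v : ℝ, |v| ≤ v₀ → ∫ u, (√(pξ u) - √(pξ (u + v))) ^ 2 ≤ I * v ^ 2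

/-- The observed data `(x_i, y_i)`, `y_i = f(x_i) + ξ_i`. -/
def sampleData {d n : ℕ} {Ω : Type u} (X : Fin n → Ω → Euc d) (ξ : Fin n → Ω → ℝ)
    (f : Euc d → ℝ) (ω : Ω) : Fin n → Euc d × ℝ :=
  fun i => (X i ω, f (X i ω) + ξ i ω)

/-- The minimax risk `inf sup E_f w(a ‖x̂_n - x^*‖)` for estimating the minimizer; the infimum is
over all measurable functions of the data. -/
noncomputable def minimaxRiskMinimizer {d n : ℕ} {Ω : Type u} [MeasurableSpace Ω] (μ : Measure Ω)
    (X : Fin n → Ω → Euc d) (ξ : Fin n → Ω → ℝ) (Θ : Set (Euc d)) (F : Set (Euc d → ℝ))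
    (w : ℝ → ℝ) (a : ℝ) : ℝ≥0∞ :=
  ⨅ (T : (Fin n → Euc d × ℝ) → Euc d) (_ : Measurable T), ⨆ f ∈ F,
    ∫⁻ ω, ENNReal.ofReal (w (a * ‖T (sampleData X ξ f ω) - minimizer Θ f‖)) ∂μ

/-- The minimax risk `inf sup E_f w(a |T_n - f^*|)` for estimating the minimum value. -/
noncomputable def minimaxRiskMinValue {d n : ℕ} {Ω : Type u} [MeasurableSpace Ω] (μ : Measure Ω)
    (X : Fin n → Ω → Euc d) (ξ : Fin n → Ω → ℝ) (Θ : Set (Euc d)) (F : Set (Euc d → ℝ))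
    (w : ℝ → ℝ) (a : ℝ) : ℝ≥0∞ :=
  ⨅ (T : (Fin n → Euc d × ℝ) → ℝ) (_ : Measurable T), ⨆ f ∈ F,
    ∫⁻ ω, ENNReal.ofReal (w (a * |T (sampleData X ξ f ω) - minValue Θ f|)) ∂μ

/-- The expectation of a real random variable in `[-∞, ∞]`: expectation of the positive part minus
expectation of the negative part (`-∞` by convention if both are infinite). -/
noncomputable def extendedExpectation {Ω : Type u} [MeasurableSpace Ω] (μ : Measure Ω)
    (Y : Ω → ℝ) : EReal :=
  ((∫⁻ ω, ENNReal.ofReal (Y ω) ∂μ : ℝ≥0∞) : EReal) -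
    ((∫⁻ ω, ENNReal.ofReal (-Y ω) ∂μ : ℝ≥0∞) : EReal)

/-- The minimax optimization risk `inf sup E_f [f(x̂_n) - f^*]`; estimators may take values outside
`Θ`, so the excess `f(x̂_n) - f^*` is not assumed to be nonnegative. -/
noncomputable def minimaxOptimizationRisk {d n : ℕ} {Ω : Type u} [MeasurableSpace Ω]
    (μ : Measure Ω) (X : Fin n → Ω → Euc d) (ξ : Fin n → Ω → ℝ) (Θ : Set (Euc d))
    (F : Set (Euc d → ℝ)) : EReal :=
  ⨅ (T : (Fin n → Euc d × ℝ) → Euc d) (_ : Measurable T), ⨆ f ∈ F,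
    extendedExpectation μ (fun ω => f (T (sampleData X ξ f ω)) - minValue Θ f)

/-!
The lower bound is a two-point argument. The hypotheses are the quadratic
`f y = c α / 2 * ‖y - x₀‖ ^ 2` and `g y = f y + r h ^ β η ((y - x₀) / h)`, where `h` is of the order
of `n ^ (-1 / (2 β + d))` and the smooth profile `η`, supported in the unit ball, equals
`1 + ⟨e, ·⟩` near the origin for a unit vector `e`. The linear part of `η` moves the minimizer by
`r h ^ (β - 1) / (c α)` and its constant part raises the minimum by the order of `h ^ β`, so this
single pair serves for all three risks. The factor `c`, with `1 < c < 1 / κ`, leaves room for the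
bump in the strong convexity condition (it costs a curvature of order `r h ^ (β - 2)`) and, when
`β = 2`, in the Hölder condition. If `α` is smaller than a multiple of `h ^ (β - 2)`, it is first
raised to that size, which only shrinks the class; this is where the second regime of the rates
comes from. Both functions are strongly convex on the whole space, so the excess risk is bounded
from below by the squared distance to the minimizer even for estimators outside `Θ`
(`exists_isHypothesisPair`).

The two data distributions are compared through Hellinger affinities. Given the design, the
affinity is a product of affinities of shifted noise densities, which the regularity condition on
the noise bounds from below; integrating over the i.i.d. design gives
`(1 - I V ^ 2 Q(S)) ^ n`, where the functions differ by at most `V` on the support `S` of the bump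
and `Q` is the design distribution (`two_point_testing`). The constants do not involve the bound
on the design density: averaging `Q` of a ball of radius `h` over its centre yields a centre `x₀`
where it is at most of order `h ^ d` (`exists_measure_ball_le`). Hence `n I V ^ 2 Q(S)` stays
bounded, and no estimator can be closer than half the separation under both hypotheses.

A loss that vanishes near zero requires a large separation in units of the rate: there
`h = B n ^ (-1 / (2 β + d))` with a large `B`, and `n` large enough for `h` to fit into `Θ`.
-/

/-! ### Testing two regression functions -/

/-- Tonelli's theorem for a product of functions of one coordinate each. -/
theorem lintegral_pi_prod {E : Type*} [MeasurableSpace E] {n : ℕ} (ν : Fin n → Measure E)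
    [∀ i, SigmaFinite (ν i)] (f : Fin n → E → ℝ≥0∞) (hf : ∀ i, Measurable (f i)) :
    ∫⁻ x, ∏ i, f i (x i) ∂Measure.pi ν = ∏ i, ∫⁻ x, f i x ∂ν i := by
  induction n with
  | zero => simp
  | succ n ih =>
    have hmp := measurePreserving_piFinSuccAbove ν 0
    rw [← hmp.symm.lintegral_comp_emb (MeasurableEquiv.measurableEmbedding _)]
    have h := lintegral_prod_mul (μ := ν 0) (ν := Measure.pi fun j => ν (Fin.succAbove 0 j))
      (g := fun y : Fin n → E => ∏ i : Fin n, f i.succ (y i)) (hf 0).aemeasurable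
      (Finset.measurable_prod _ fun i _ =>
        (hf i.succ).comp (measurable_pi_apply i)).aemeasurable
    have ih' := ih (fun i => ν i.succ) (fun i => f i.succ) (fun i => hf i.succ)
    simp only [Fin.zero_succAbove] at h
    rw [ih'] at h
    rw [Fin.prod_univ_succ (fun i => ∫⁻ x, f i x ∂ν i), ← h]
    refine lintegral_congr fun a => ?_
    rw [Fin.prod_univ_succ]
    rfl

theorem pi_withDensity {n : ℕ} (f : ℝ → ℝ≥0∞) (hf : Measurable f)
    [SigmaFinite ((volume : Measure ℝ).withDensity f)] :
    Measure.pi (fun _ : Fin n => (volume : Measure ℝ).withDensity f) =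
      (volume : Measure (Fin n → ℝ)).withDensity (fun x => ∏ i, f (x i)) := by
  refine Measure.pi_eq fun s hs => ?_
  rw [withDensity_apply _ (MeasurableSet.univ_pi hs),
    ← lintegral_indicator (MeasurableSet.univ_pi hs)]
  have h : (Set.pi univ s).indicator (fun x : Fin n → ℝ => ∏ i, f (x i)) =
      fun x => ∏ i, (s i).indicator f (x i) := by
    funext x
    by_cases hx : x ∈ Set.pi univ s
    · rw [indicator_of_mem hx]
      exact Finset.prod_congr rfl fun i _ => (indicator_of_mem (hx i (mem_univ i)) f).symm
    · rw [indicator_of_notMem hx]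
      obtain ⟨i, hi⟩ : ∃ i, x i ∉ s i := by simpa [Set.mem_pi] using hx
      exact (Finset.prod_eq_zero (Finset.mem_univ i) (indicator_of_notMem hi f)).symm
  rw [h, volume_pi, lintegral_pi_prod _ _ fun i => hf.indicator (hs i)]
  exact Finset.prod_congr rfl fun i _ => by
    rw [withDensity_apply _ (hs i), lintegral_indicator (hs i)]

/-- Le Cam's inequality: the sum of the two error probabilities of a test is at least half the
squared Hellinger affinity of the two hypotheses. -/
theorem half_sq_affinity_le {E : Type*} [MeasurableSpace E] (ν : Measure E) {p q : E → ℝ≥0∞}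
    (hp : Measurable p) (hq : Measurable q) (hp1 : ∫⁻ x, p x ∂ν = 1) (hq1 : ∫⁻ x, q x ∂ν = 1)
    {A : Set E} (hA : MeasurableSet A) :
    2⁻¹ * (∫⁻ x, p x ^ (1 / 2 : ℝ) * q x ^ (1 / 2 : ℝ) ∂ν) ^ 2 ≤
      ∫⁻ x in A, p x ∂ν + ∫⁻ x in Aᶜ, q x ∂ν := by
  have cs : ∀ s : Set E, ∫⁻ x in s, p x ^ (1 / 2 : ℝ) * q x ^ (1 / 2 : ℝ) ∂ν ≤
      (∫⁻ x in s, p x ∂ν) ^ (1 / 2 : ℝ) * (∫⁻ x in s, q x ∂ν) ^ (1 / 2 : ℝ) := fun s =>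
    ENNReal.lintegral_mul_norm_pow_le hp.aemeasurable hq.aemeasurable (by norm_num) (by norm_num)
      (by norm_num)
  have hle : ∀ {r : E → ℝ≥0∞} (s : Set E), ∫⁻ x, r x ∂ν = 1 →
      (∫⁻ x in s, r x ∂ν) ^ (1 / 2 : ℝ) ≤ 1 := fun s h =>
    ENNReal.rpow_le_one ((setLIntegral_le_lintegral s _).trans h.le) (by norm_num)
  have h1 : ∫⁻ x, p x ^ (1 / 2 : ℝ) * q x ^ (1 / 2 : ℝ) ∂ν ≤
      (∫⁻ x in A, p x ∂ν) ^ (1 / 2 : ℝ) + (∫⁻ x in Aᶜ, q x ∂ν) ^ (1 / 2 : ℝ) := by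
    rw [← lintegral_add_compl _ hA]
    exact add_le_add ((cs A).trans (mul_le_of_le_one_right' (hle A hq1)))
      ((cs Aᶜ).trans (mul_le_of_le_one_left' (hle Aᶜ hp1)))
  have h2 := ENNReal.rpow_add_le_mul_rpow_add_rpow ((∫⁻ x in A, p x ∂ν) ^ (1 / 2 : ℝ))
    ((∫⁻ x in Aᶜ, q x ∂ν) ^ (1 / 2 : ℝ)) (p := 2) (by norm_num)
  rw [← ENNReal.rpow_mul, ← ENNReal.rpow_mul] at h2
  norm_num at h2
  calc _ ≤ 2⁻¹ * (2 * (∫⁻ x in A, p x ∂ν + ∫⁻ x in Aᶜ, q x ∂ν)) := by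
        gcongr
        exact (pow_le_pow_left' h1 2).trans (by simpa using h2)
    _ = _ := by
        rw [← mul_assoc, ENNReal.inv_mul_cancel (by norm_num) (by norm_num), one_mul]

/-- The Hellinger affinity of the noise density and its translate by `v`. -/
noncomputable def shiftAffinity (p : ℝ → ℝ) (v : ℝ) : ℝ≥0∞ :=
  ∫⁻ u, ENNReal.ofReal (p u) ^ (1 / 2 : ℝ) * ENNReal.ofReal (p (u - v)) ^ (1 / 2 : ℝ)

theorem measurable_shiftAffinity {p : ℝ → ℝ} (hp : Measurable p) :
    Measurable (shiftAffinity p) := by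
  unfold shiftAffinity
  have : Measurable (fun z : ℝ × ℝ => ENNReal.ofReal (p z.2) ^ (1 / 2 : ℝ) *
      ENNReal.ofReal (p (z.2 - z.1)) ^ (1 / 2 : ℝ)) := by fun_prop
  exact this.lintegral_prod_right'

/-- The Hellinger condition bounds the affinity `ρ` of a shift from below: the squared distance
is `2 - 2 ρ`, hence `ρ ≥ 1 - I v ^ 2 / 2`. The additive form avoids truncated subtraction. -/
theorem one_le_sq_shiftAffinity_add {p : ℝ → ℝ} (hp : Measurable p) (hp0 : ∀ u, 0 ≤ p u)
    (hp1 : ∫⁻ u, ENNReal.ofReal (p u) = 1) {I v₀ : ℝ} (hI : 0 ≤ I) (h : HellingerRegular I v₀ p)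
    {v : ℝ} (hv : |v| ≤ v₀) :
    1 ≤ shiftAffinity p v ^ 2 + ENNReal.ofReal (I * v ^ 2) := by
  have hint : Integrable p :=
    ⟨hp.aestronglyMeasurable, by
      rw [hasFiniteIntegral_iff_ofReal (Filter.Eventually.of_forall hp0), hp1]
      exact ENNReal.one_lt_top⟩
  have hone : ∫ u, p u = 1 := by
    rw [integral_eq_lintegral_of_nonneg_ae (Filter.Eventually.of_forall hp0)
      hp.aestronglyMeasurable, hp1, ENNReal.toReal_one]
  have hint' : Integrable (fun u => p (u + -v)) := hint.comp_add_right (-v)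
  have hone' : ∫ u, p (u + -v) = 1 := by rw [integral_add_right_eq_self, hone]
  have hcross : Integrable (fun u => √(p u) * √(p (u + -v))) := by
    refine (hint.add hint').mono' (by fun_prop) (Filter.Eventually.of_forall fun u => ?_)
    rw [Real.norm_of_nonneg (by positivity), Pi.add_apply]
    nlinarith [Real.sq_sqrt (hp0 u), Real.sq_sqrt (hp0 (u + -v)),
      sq_nonneg (√(p u) - √(p (u + -v))), hp0 u, hp0 (u + -v)]
  have hexp : ∫ u, (√(p u) - √(p (u + -v))) ^ 2 = 2 - 2 * ∫ u, √(p u) * √(p (u + -v)) := by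
    have : (fun u => (√(p u) - √(p (u + -v))) ^ 2) =
        fun u => (p u + p (u + -v)) - 2 * (√(p u) * √(p (u + -v))) := by
      funext u
      nlinarith [Real.sq_sqrt (hp0 u), Real.sq_sqrt (hp0 (u + -v))]
    have hsum : Integrable fun u => p u + p (u + -v) := hint.add hint'
    rw [this, integral_sub hsum (hcross.const_mul 2), integral_add hint hint',
      integral_const_mul, hone, hone']
    norm_num
  have hR : shiftAffinity p v = ENNReal.ofReal (∫ u, √(p u) * √(p (u + -v))) := by
    rw [ofReal_integral_eq_lintegral_ofReal hcross (Filter.Eventually.of_forall fun u => by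
      positivity)]
    refine lintegral_congr fun u => ?_
    rw [ENNReal.ofReal_mul (Real.sqrt_nonneg _), Real.sqrt_eq_rpow, Real.sqrt_eq_rpow,
      ENNReal.ofReal_rpow_of_nonneg (hp0 _) (by norm_num),
      ENNReal.ofReal_rpow_of_nonneg (hp0 _) (by norm_num), sub_eq_add_neg]
  have hR0 : 0 ≤ ∫ u, √(p u) * √(p (u + -v)) := integral_nonneg fun u => by positivity
  have hH := h (-v) (by rwa [abs_neg])
  rw [hexp, neg_sq] at hH
  rw [hR, ← ENNReal.ofReal_pow hR0, ← ENNReal.ofReal_add (by positivity) (by positivity),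
    ← ENNReal.ofReal_one]
  refine ENNReal.ofReal_le_ofReal ?_
  set R := ∫ u, √(p u) * √(p (u + -v))
  rcases le_total 1 (I * v ^ 2) with h1 | h1
  · nlinarith [sq_nonneg R]
  · nlinarith [sq_nonneg (1 - R)]

/-- The two-point testing bound conditional on the design: only the shift `v` between the two
vectors of regression values matters. -/
theorem half_prod_sq_shiftAffinity_le {p : ℝ → ℝ} (hp : Measurable p)
    (hp1 : ∫⁻ u, ENNReal.ofReal (p u) = 1) {n : ℕ} (v : Fin n → ℝ) {B : Set (Fin n → ℝ)}
    (hB : MeasurableSet B) :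
    2⁻¹ * ∏ i, shiftAffinity p (v i) ^ 2 ≤
      (volume.withDensity fun u : Fin n → ℝ => ∏ i, ENNReal.ofReal (p (u i))) B +
      (volume.withDensity fun u : Fin n → ℝ => ∏ i, ENNReal.ofReal (p (u i)))
        {u | v + u ∈ Bᶜ} := by
  have hP : Measurable fun u : Fin n → ℝ => ∏ i, ENNReal.ofReal (p (u i)) := by fun_prop
  have hQ : Measurable fun u : Fin n → ℝ => ∏ i, ENNReal.ofReal (p (u i - v i)) := by fun_prop
  have hP1 : ∫⁻ u : Fin n → ℝ, ∏ i, ENNReal.ofReal (p (u i)) = 1 := by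
    rw [volume_pi, lintegral_pi_prod (fun _ => volume) (fun _ u => ENNReal.ofReal (p u))
      fun _ => by fun_prop]
    rw [Finset.prod_congr rfl fun _ _ => hp1, Finset.prod_const_one]
  have hQ1 : ∫⁻ u : Fin n → ℝ, ∏ i, ENNReal.ofReal (p (u i - v i)) = 1 := by
    rw [← hP1]
    exact lintegral_sub_right_eq_self (μ := volume)
      (fun u : Fin n → ℝ => ∏ i, ENNReal.ofReal (p (u i))) v
  have haff : ∫⁻ u : Fin n → ℝ, (∏ i, ENNReal.ofReal (p (u i))) ^ (1 / 2 : ℝ) *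
      (∏ i, ENNReal.ofReal (p (u i - v i))) ^ (1 / 2 : ℝ) = ∏ i, shiftAffinity p (v i) := by
    have hprod : ∀ u : Fin n → ℝ, (∏ i, ENNReal.ofReal (p (u i))) ^ (1 / 2 : ℝ) *
        (∏ i, ENNReal.ofReal (p (u i - v i))) ^ (1 / 2 : ℝ) =
        ∏ i, ENNReal.ofReal (p (u i)) ^ (1 / 2 : ℝ) *
          ENNReal.ofReal (p (u i - v i)) ^ (1 / 2 : ℝ) := fun u => by
      rw [Finset.prod_mul_distrib, ENNReal.prod_rpow_of_nonneg (by norm_num),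
        ENNReal.prod_rpow_of_nonneg (by norm_num)]
    rw [lintegral_congr hprod, volume_pi, lintegral_pi_prod (fun _ => volume)
      (fun i u => ENNReal.ofReal (p u) ^ (1 / 2 : ℝ) * ENNReal.ofReal (p (u - v i)) ^ (1 / 2 : ℝ))
      fun _ => by fun_prop]
    rfl
  have key := half_sq_affinity_le volume hP hQ hP1 hQ1 hB
  rw [haff, ← Finset.prod_pow] at key
  refine key.trans (le_of_eq ?_)
  have hv : MeasurableSet {u | v + u ∈ Bᶜ} := hB.compl.preimage (measurable_const_add v)
  rw [withDensity_apply _ hB, withDensity_apply _ hv, ← lintegral_indicator hv,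
    ← lintegral_indicator hB.compl]
  congr 1
  rw [← lintegral_add_left_eq_self _ v]
  refine lintegral_congr fun u => ?_
  by_cases hu : v + u ∈ Bᶜ
  · rw [indicator_of_mem hu, indicator_of_mem (show u ∈ {u | v + u ∈ Bᶜ} from hu)]
    simp
  · rw [indicator_of_notMem hu, indicator_of_notMem (show u ∉ {u | v + u ∈ Bᶜ} from hu)]

/-- The two-point testing bound for the regression model: if two regression functions differ only
on `S`, where their distance is at most `V`, every test between them has a sum of error
probabilities bounded from below in terms of the design probability of `S`. -/
theorem two_point_testing {d n : ℕ} {Ω : Type u} [MeasurableSpace Ω] {μ : Measure Ω}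
    [IsProbabilityMeasure μ] {X : Fin n → Ω → Euc d} {ξ : Fin n → Ω → ℝ} {pξ : ℝ → ℝ}
    (hn : 1 ≤ n) (hs : IsPassiveSample μ X ξ pξ) {I v₀ V : ℝ} (hI : 0 ≤ I)
    (hreg : HellingerRegular I v₀ pξ)
    {Q : Measure (Euc d)} (hQ : ∀ i, μ.map (X i) = Q) {f g : Euc d → ℝ} (hf : Measurable f)
    (hg : Measurable g) (hVv : V ≤ v₀) (hV : ∀ x, |g x - f x| ≤ V) {S : Set (Euc d)}
    (hS : MeasurableSet S) (hfg : ∀ x ∉ S, g x = f x) {A : Set (Fin n → Euc d × ℝ)}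
    (hA : MeasurableSet A) :
    2⁻¹ * (1 - ENNReal.ofReal (I * V ^ 2) * Q S) ^ n ≤
      μ {ω | sampleData X ξ f ω ∈ A} + μ {ω | sampleData X ξ g ω ∈ Aᶜ} := by
  have i₀ : Fin n := ⟨0, hn⟩
  have hQprob : IsProbabilityMeasure Q :=
    hQ i₀ ▸ Measure.isProbabilityMeasure_map (hs.measurable_design i₀).aemeasurable
  have hNprob : IsProbabilityMeasure
      ((volume : Measure ℝ).withDensity fun u => ENNReal.ofReal (pξ u)) :=
    hs.noise_density i₀ ▸ Measure.isProbabilityMeasure_map (hs.measurable_noise i₀).aemeasurable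
  have hpm : Measurable pξ := hs.measurable_noise_density
  have hp1 : ∫⁻ u, ENNReal.ofReal (pξ u) = 1 := by
    rw [← hNprob.measure_univ, withDensity_apply _ MeasurableSet.univ, setLIntegral_univ]
  have hXm : Measurable fun ω i => X i ω := measurable_pi_lambda _ hs.measurable_design
  have hξm : Measurable fun ω i => ξ i ω := measurable_pi_lambda _ hs.measurable_noise
  set N : Measure (Fin n → ℝ) :=
    volume.withDensity fun u : Fin n → ℝ => ∏ i, ENNReal.ofReal (pξ (u i)) with hN
  have hNpi : Measure.pi (fun _ : Fin n =>
      (volume : Measure ℝ).withDensity fun u => ENNReal.ofReal (pξ u)) = N :=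
    pi_withDensity (fun u => ENNReal.ofReal (pξ u)) (by fun_prop)
  have hNp : IsProbabilityMeasure N := hNpi ▸ inferInstance
  have hlaw : μ.map (fun ω => ((fun i => X i ω), (fun i => ξ i ω))) =
      (Measure.pi fun _ : Fin n => Q).prod N := by
    rw [(indepFun_iff_map_prod_eq_prod_map_map hXm.aemeasurable hξm.aemeasurable).1 hs.indep,
      hs.indep_design.map_fun_eq_pi_map fun i => (hs.measurable_design i).aemeasurable,
      hs.indep_noise.map_fun_eq_pi_map fun i => (hs.measurable_noise i).aemeasurable]
    simp_rw [hQ, hs.noise_density]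
    rw [hNpi]
  have hlawf : ∀ {φ : Euc d → ℝ}, Measurable φ → ∀ {C : Set (Fin n → Euc d × ℝ)},
      MeasurableSet C → μ {ω | sampleData X ξ φ ω ∈ C} =
        ∫⁻ x, N {u | (fun i => (x i, φ (x i) + u i)) ∈ C} ∂Measure.pi fun _ : Fin n => Q := by
    intro φ hφ C hC
    have hm : Measurable fun z : (Fin n → Euc d) × (Fin n → ℝ) =>
        (fun i => (z.1 i, φ (z.1 i) + z.2 i) : Fin n → Euc d × ℝ) := by fun_prop
    have h1 := Measure.prod_apply (μ := Measure.pi fun _ : Fin n => Q) (ν := N)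
      (hC.preimage hm)
    rw [← hlaw, Measure.map_apply (hXm.prodMk hξm) (hC.preimage hm)] at h1
    exact h1
  rw [hlawf hf hA, hlawf hg hA.compl]
  have hvm : Measurable fun x => g x - f x := hg.sub hf
  have hsm := measurable_shiftAffinity hpm
  have hmeasf : Measurable fun x : Fin n → Euc d =>
      N {u | (fun i => (x i, f (x i) + u i)) ∈ A} := by
    have hm : Measurable fun z : (Fin n → Euc d) × (Fin n → ℝ) =>
        (fun i => (z.1 i, f (z.1 i) + z.2 i) : Fin n → Euc d × ℝ) := by fun_prop
    exact measurable_measure_prodMk_left (hA.preimage hm)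
  rw [← lintegral_add_left hmeasf]
  have hcond : ∀ x : Fin n → Euc d,
      2⁻¹ * ∏ i, shiftAffinity pξ (g (x i) - f (x i)) ^ 2 ≤
        N {u | (fun i => (x i, f (x i) + u i)) ∈ A} +
          N {u | (fun i => (x i, g (x i) + u i)) ∈ Aᶜ} := by
    intro x
    have hm : Measurable fun u : Fin n → ℝ =>
        (fun i => (x i, f (x i) + u i) : Fin n → Euc d × ℝ) := by fun_prop
    refine (half_prod_sq_shiftAffinity_le hpm hp1 (fun i => g (x i) - f (x i))
      (hA.preimage hm)).trans (le_of_eq ?_)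
    congr 2
    ext u
    simp only [mem_compl_iff, mem_preimage, mem_ofPred_eq, Pi.add_apply]
    have : (fun i => (x i, f (x i) + (g (x i) - f (x i) + u i)) : Fin n → Euc d × ℝ) =
        fun i => (x i, g (x i) + u i) := by
      funext i
      congr 1
      ring
    rw [this]
  have hone : 1 - ENNReal.ofReal (I * V ^ 2) * Q S ≤
      ∫⁻ x, shiftAffinity pξ (g x - f x) ^ 2 ∂Q := by
    rw [tsub_le_iff_right, ← lintegral_indicator_const hS, ← lintegral_add_right _
      (measurable_const.indicator hS)]
    calc (1 : ℝ≥0∞) = ∫⁻ _, 1 ∂Q := by simp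
      _ ≤ _ := by
        refine lintegral_mono fun x => ?_
        refine (one_le_sq_shiftAffinity_add hpm hs.noise_density_nonneg hp1 hI hreg
          ((hV x).trans hVv)).trans (add_le_add le_rfl ?_)
        by_cases hx : x ∈ S
        · rw [indicator_of_mem hx]
          refine ENNReal.ofReal_le_ofReal (mul_le_mul_of_nonneg_left ?_ hI)
          exact sq_le_sq' (neg_le_of_abs_le (hV x)) (le_of_abs_le (hV x))
        · simp [hfg x hx]
  calc 2⁻¹ * (1 - ENNReal.ofReal (I * V ^ 2) * Q S) ^ n
      ≤ 2⁻¹ * ∫⁻ x, ∏ i, shiftAffinity pξ (g (x i) - f (x i)) ^ 2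
          ∂Measure.pi fun _ : Fin n => Q := by
        rw [lintegral_pi_prod (fun _ => Q) (fun _ x => shiftAffinity pξ (g x - f x) ^ 2)
          fun _ => (hsm.comp hvm).pow_const 2]
        simp only [Finset.prod_const, Finset.card_univ, Fintype.card_fin]
        gcongr
    _ = ∫⁻ x, 2⁻¹ * ∏ i, shiftAffinity pξ (g (x i) - f (x i)) ^ 2
          ∂Measure.pi fun _ : Fin n => Q := by
        rw [lintegral_const_mul]
        exact Finset.measurable_prod _ fun i _ =>
          ((hsm.comp hvm).pow_const 2).comp (measurable_pi_apply i)
    _ ≤ _ := lintegral_mono hcond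

/-! ### Taylor remainders on Euclidean space -/

open scoped ContDiff in
theorem iteratedDeriv_comp_line {d : ℕ} {f : Euc d → ℝ} {k : ℕ} (hf : ContDiff ℝ k f)
    (x v : Euc d) (t : ℝ) :
    iteratedDeriv k (fun t : ℝ => f (x + t • v)) t =
      iteratedFDeriv ℝ k f (x + t • v) (fun _ => v) := by
  have h := (ContinuousLinearMap.toSpanSingleton ℝ v).iteratedFDeriv_comp_right
    (f := fun z => f (x + z)) (hf.comp (contDiff_const.add contDiff_id)) t le_rfl
  rw [iteratedDeriv_eq_iteratedFDeriv]
  change iteratedFDeriv ℝ k ((fun z => f (x + z)) ∘ ContinuousLinearMap.toSpanSingleton ℝ v) t _ = _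
  rw [h, iteratedFDeriv_comp_add_left]
  simp [ContinuousMultilinearMap.compContinuousLinearMap_apply]

theorem taylorPoly_eq_sum_iteratedDeriv {d : ℕ} {f : Euc d → ℝ} {l : ℕ} (hf : ContDiff ℝ l f)
    (x x' : Euc d) :
    taylorPoly l f x x' = ∑ k ∈ Finset.range (l + 1),
      ((k.factorial : ℝ))⁻¹ * iteratedDeriv k (fun t : ℝ => f (x + t • (x' - x))) 0 := by
  refine Finset.sum_congr rfl fun k hk => ?_
  rw [iteratedDeriv_comp_line (hf.of_le (by exact_mod_cast Finset.mem_range_succ_iff.1 hk))]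
  simp

/-- The remainder of the Taylor expansion of order `l` of `f` at `x`. -/
noncomputable def taylorRemainder {d : ℕ} (l : ℕ) (f : Euc d → ℝ) (x x' : Euc d) : ℝ :=
  f x' - taylorPoly l f x x'

theorem taylorRemainder_add {d l : ℕ} {f g : Euc d → ℝ} (hf : ContDiff ℝ l f)
    (hg : ContDiff ℝ l g) (x x' : Euc d) :
    taylorRemainder l (fun y => f y + g y) x x' =
      taylorRemainder l f x x' + taylorRemainder l g x x' := by
  have : taylorPoly l (fun y => f y + g y) x x' = taylorPoly l f x x' + taylorPoly l g x x' := by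
    unfold taylorPoly
    rw [← Finset.sum_add_distrib]
    refine Finset.sum_congr rfl fun k hk => ?_
    have hk' : (k : WithTop ℕ∞) ≤ l := by exact_mod_cast Finset.mem_range_succ_iff.1 hk
    rw [fun_iteratedFDeriv_add_apply (hf.of_le hk').contDiffAt (hg.of_le hk').contDiffAt]
    simp [mul_add]
  simp only [taylorRemainder, this]
  ring

/-- Lagrange form of the Taylor remainder, along the segment from `x` to `x'`. -/
theorem exists_taylorRemainder_eq {d l : ℕ} {f : Euc d → ℝ}
    (hf : ContDiff ℝ ((l + 1 : ℕ) : WithTop ℕ∞) f) (x x' : Euc d) :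
    ∃ t : ℝ, taylorRemainder l f x x' =
      iteratedDeriv (l + 1) (fun t : ℝ => f (x + t • (x' - x))) t / (l + 1).factorial := by
  have hφ : ContDiff ℝ ((l + 1 : ℕ) : WithTop ℕ∞) fun t : ℝ => f (x + t • (x' - x)) :=
    hf.comp (contDiff_const.add (contDiff_id.smul contDiff_const))
  obtain ⟨t, -, ht⟩ := taylor_mean_remainder_lagrange_iteratedDeriv (x₀ := 0) (x := 1) (n := l)
    zero_ne_one (by exact_mod_cast hφ.contDiffOn)
  refine ⟨t, ?_⟩
  rw [taylor_within_apply] at ht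
  rw [taylorRemainder, taylorPoly_eq_sum_iteratedDeriv (hf.of_le (by exact_mod_cast l.le_succ))]
  simp only [one_smul, add_sub_cancel, sub_zero, one_pow, mul_one, smul_eq_mul] at ht
  rw [← ht]
  congr 1
  refine Finset.sum_congr rfl fun k hk => ?_
  rw [iteratedDerivWithin_eq_iteratedDeriv (uniqueDiffOn_uIcc zero_ne_one)
    (hφ.contDiffAt.of_le (by exact_mod_cast (Finset.mem_range.1 hk).le)) left_mem_uIcc]

theorem abs_iteratedDeriv_comp_line_le {d k : ℕ} {f : Euc d → ℝ} (hf : ContDiff ℝ k f) {B : ℝ}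
    (hB : ∀ z, ‖iteratedFDeriv ℝ k f z‖ ≤ B) (x v : Euc d) (t : ℝ) :
    |iteratedDeriv k (fun t : ℝ => f (x + t • v)) t| ≤ B * ‖v‖ ^ k := by
  rw [iteratedDeriv_comp_line hf, ← Real.norm_eq_abs]
  refine (ContinuousMultilinearMap.le_opNorm _ _).trans ?_
  rw [Finset.prod_const, Finset.card_univ, Fintype.card_fin]
  exact mul_le_mul_of_nonneg_right (hB _) (by positivity)

open scoped ContDiff in
/-- A smooth function with compact support belongs to every Hölder class, up to a constant:
the Lagrange remainder controls nearby points, and crude bounds suffice for distant points. -/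
theorem exists_abs_taylorRemainder_le {d : ℕ} {η : Euc d → ℝ} (hη : ContDiff ℝ ∞ η)
    (hc : HasCompactSupport η) {l : ℕ} {γ : ℝ} (h1 : l ≤ γ) (h2 : γ ≤ l + 1) :
    ∃ C : ℝ, 0 ≤ C ∧ ∀ x x', |taylorRemainder l η x x'| ≤ C * ‖x' - x‖ ^ γ := by
  have hb : ∀ k : ℕ, ∃ B : ℝ, ∀ z, ‖iteratedFDeriv ℝ k η z‖ ≤ B := fun k =>
    (hη.continuous_iteratedFDeriv (by exact_mod_cast le_top)).bounded_above_of_compact_support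
      (hc.iteratedFDeriv k)
  choose B hB using hb
  have hB0 : ∀ k, 0 ≤ B k := fun k => (norm_nonneg _).trans (hB k 0)
  have hk : ∀ k : ℕ, ContDiff ℝ k η := fun k => hη.of_le (by exact_mod_cast le_top)
  refine ⟨B (l + 1) + (B 0 + ∑ k ∈ Finset.range (l + 1), B k), ?_, fun x x' => ?_⟩
  · have := Finset.sum_nonneg (s := Finset.range (l + 1)) (f := B) fun k _ => hB0 k
    linarith [hB0 0, hB0 (l + 1)]
  have hsum := Finset.sum_nonneg (s := Finset.range (l + 1)) (f := B) fun k _ => hB0 k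
  rcases le_total ‖x' - x‖ 1 with hx | hx
  · obtain ⟨t, ht⟩ := exists_taylorRemainder_eq (hk (l + 1)) x x'
    rw [ht, abs_div, Nat.abs_cast]
    calc _ ≤ |iteratedDeriv (l + 1) (fun t : ℝ => η (x + t • (x' - x))) t| :=
          div_le_self (abs_nonneg _) (by exact_mod_cast Nat.succ_le_of_lt (Nat.factorial_pos _))
      _ ≤ B (l + 1) * ‖x' - x‖ ^ (l + 1) :=
          abs_iteratedDeriv_comp_line_le (hk _) (hB _) _ _ _
      _ ≤ B (l + 1) * ‖x' - x‖ ^ γ := by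
          refine mul_le_mul_of_nonneg_left ?_ (hB0 _)
          rw [← Real.rpow_natCast]
          rcases (norm_nonneg (x' - x)).eq_or_lt with h0 | h0
          · rw [← h0, Real.zero_rpow (by positivity)]
            exact Real.rpow_nonneg le_rfl _
          · exact Real.rpow_le_rpow_of_exponent_ge h0 hx (by exact_mod_cast h2)
      _ ≤ _ := by
          refine mul_le_mul_of_nonneg_right ?_ (Real.rpow_nonneg (norm_nonneg _) _)
          linarith [hB0 0]
  · have hγ1 : ∀ k ∈ Finset.range (l + 1), ‖x' - x‖ ^ k ≤ ‖x' - x‖ ^ γ := fun k hk => by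
      rw [← Real.rpow_natCast]
      refine Real.rpow_le_rpow_of_exponent_le hx (le_trans ?_ h1)
      exact_mod_cast Finset.mem_range_succ_iff.1 hk
    have hη0 : |η x'| ≤ B 0 := by simpa using hB 0 x'
    rw [taylorRemainder, taylorPoly_eq_sum_iteratedDeriv (hk l)]
    calc _ ≤ |η x'| + ∑ k ∈ Finset.range (l + 1), |((k.factorial : ℝ))⁻¹ *
            iteratedDeriv k (fun t : ℝ => η (x + t • (x' - x))) 0| :=
          (abs_sub _ _).trans (add_le_add le_rfl (Finset.abs_sum_le_sum_abs _ _))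
      _ ≤ B 0 * ‖x' - x‖ ^ γ + ∑ k ∈ Finset.range (l + 1), B k * ‖x' - x‖ ^ γ := by
          refine add_le_add ?_ (Finset.sum_le_sum fun k hkl => ?_)
          · have := hγ1 0 (by simp)
            rw [pow_zero] at this
            nlinarith [hB0 0]
          · rw [abs_mul, abs_of_nonneg (by positivity : (0 : ℝ) ≤ ((k.factorial : ℝ))⁻¹)]
            refine (mul_le_of_le_one_left (abs_nonneg _) (inv_le_one_of_one_le₀
              (by exact_mod_cast Nat.succ_le_of_lt (Nat.factorial_pos _)))).trans ?_
            exact (abs_iteratedDeriv_comp_line_le (hk k) (hB k) _ _ _).trans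
              (mul_le_mul_of_nonneg_left (hγ1 k hkl) (hB0 k))
      _ = (B 0 + ∑ k ∈ Finset.range (l + 1), B k) * ‖x' - x‖ ^ γ := by
          rw [← Finset.sum_mul]; ring
      _ ≤ _ := by
          refine mul_le_mul_of_nonneg_right ?_ (Real.rpow_nonneg (norm_nonneg _) _)
          linarith [hB0 (l + 1)]

theorem taylorRemainder_const_mul_comp_rescale {d l : ℕ} {η : Euc d → ℝ} (hη : ContDiff ℝ l η)
    (m h : ℝ) (x₀ x x' : Euc d) :
    taylorRemainder l (fun y => m * η (h • (y - x₀))) x x' =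
      m * taylorRemainder l η (h • (x - x₀)) (h • (x' - x₀)) := by
  have hg : ContDiff ℝ l fun y : Euc d => m * η (h • (y - x₀)) :=
    contDiff_const.mul (hη.comp (by fun_prop : ContDiff ℝ l fun y => h • (y - x₀)))
  rw [taylorRemainder, taylorRemainder, taylorPoly_eq_sum_iteratedDeriv hg,
    taylorPoly_eq_sum_iteratedDeriv hη, mul_sub, Finset.mul_sum]
  congr 1
  refine Finset.sum_congr rfl fun k _ => ?_
  have : (fun t : ℝ => m * η (h • (x + t • (x' - x) - x₀))) = fun t : ℝ =>
      m * η (h • (x - x₀) + t • (h • (x' - x₀) - h • (x - x₀))) := by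
    funext t
    congr 2
    module
  rw [this, iteratedDeriv_const_mul_field]
  ring

theorem contDiff_quadratic {d : ℕ} (A : ℝ) (x₀ : Euc d) {k : WithTop ℕ∞} :
    ContDiff ℝ k fun y : Euc d => A / 2 * ‖y - x₀‖ ^ 2 :=
  contDiff_const.mul ((contDiff_id.sub contDiff_const).norm_sq ℝ)

theorem iteratedDeriv_quadratic_line {d : ℕ} (A : ℝ) (x₀ x v : Euc d) (k : ℕ) (t : ℝ) :
    iteratedDeriv (k + 2) (fun t : ℝ => A / 2 * ‖x + t • v - x₀‖ ^ 2) t =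
      if k = 0 then A * ‖v‖ ^ 2 else 0 := by
  have h0 : (fun t : ℝ => A / 2 * ‖x + t • v - x₀‖ ^ 2) = fun t : ℝ =>
      A / 2 * ‖x - x₀‖ ^ 2 + A * inner ℝ (x - x₀) v * t + A / 2 * ‖v‖ ^ 2 * t ^ 2 := by
    funext t
    rw [show x + t • v - x₀ = (x - x₀) + t • v by module, norm_add_sq_real, inner_smul_right,
      norm_smul, mul_pow, Real.norm_eq_abs, sq_abs]
    ring
  have h1 : deriv (fun t : ℝ =>
      A / 2 * ‖x - x₀‖ ^ 2 + A * inner ℝ (x - x₀) v * t + A / 2 * ‖v‖ ^ 2 * t ^ 2) =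
      fun t => A * inner ℝ (x - x₀) v + A * ‖v‖ ^ 2 * t := by
    funext t
    refine HasDerivAt.deriv ?_
    have := (((hasDerivAt_id t).const_mul (A * inner ℝ (x - x₀) v)).const_add
      (A / 2 * ‖x - x₀‖ ^ 2)).add (((hasDerivAt_id t).pow 2).const_mul (A / 2 * ‖v‖ ^ 2))
    refine this.congr_deriv ?_
    simp
    ring
  have h2 : deriv (fun t : ℝ => A * inner ℝ (x - x₀) v + A * ‖v‖ ^ 2 * t) =
      fun _ => A * ‖v‖ ^ 2 := by
    funext t
    refine HasDerivAt.deriv ?_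
    simpa using ((hasDerivAt_id t).const_mul (A * ‖v‖ ^ 2)).const_add (A * inner ℝ (x - x₀) v)
  rw [h0, iteratedDeriv_succ', h1, iteratedDeriv_succ', h2, iteratedDeriv_const]

theorem taylorRemainder_quadratic {d : ℕ} (A : ℝ) (x₀ x x' : Euc d) (l : ℕ) :
    taylorRemainder (l + 1) (fun y => A / 2 * ‖y - x₀‖ ^ 2) x x' =
      if l = 0 then A / 2 * ‖x' - x‖ ^ 2 else 0 := by
  obtain ⟨t, ht⟩ := exists_taylorRemainder_eq (l := l + 1) (contDiff_quadratic A x₀) x x'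
  rw [ht, iteratedDeriv_quadratic_line]
  split_ifs with h
  · subst h
    norm_num
    ring
  · simp

theorem taylorRemainder_one {d : ℕ} (f : Euc d → ℝ) (x x' : Euc d) :
    taylorRemainder 1 f x x' = f x' - (f x + fderiv ℝ f x (x' - x)) := by
  simp [taylorRemainder, taylorPoly, Finset.sum_range_succ]

/-! ### Quadratics with a bump -/

open scoped ContDiff in
/-- A bump profile in the direction `e`: near the origin it is the affine function
`1 + ⟨e, ·⟩`, so that adding it to a quadratic both moves the minimizer and raises the minimum. -/
structure IsBumpProfile {d : ℕ} (e : Euc d) (η : Euc d → ℝ) : Prop where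
  contDiff : ContDiff ℝ ∞ η
  hasCompactSupport : HasCompactSupport η
  eq_zero : ∀ y, 1 ≤ ‖y‖ → η y = 0
  abs_le : ∀ y, |η y| ≤ 2
  eq_affine : ∀ y, ‖y‖ ≤ 1 / 2 → η y = 1 + inner ℝ e y

theorem exists_isBumpProfile {d : ℕ} {e : Euc d} (he : ‖e‖ = 1) :
    ∃ η : Euc d → ℝ, IsBumpProfile e η := by
  let φ : ContDiffBump (0 : Euc d) := ⟨1 / 2, 1, by norm_num, by norm_num⟩
  refine ⟨fun y => φ y * (1 + inner ℝ e y), ?_, φ.hasCompactSupport.mul_right, ?_, ?_, ?_⟩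
  · exact φ.contDiff.mul (contDiff_const.add (contDiff_const.inner ℝ contDiff_id))
  · intro y hy
    rw [φ.zero_of_le_dist (by rwa [dist_zero_right]), zero_mul]
  · intro y
    rcases le_total 1 ‖y‖ with hy | hy
    · rw [φ.zero_of_le_dist (by rwa [dist_zero_right]), zero_mul]
      norm_num
    · have h1 := abs_real_inner_le_norm e y
      rw [he, one_mul] at h1
      rw [abs_mul, abs_of_nonneg φ.nonneg]
      have h2 : |1 + inner ℝ e y| ≤ 2 := by
        refine (abs_add_le _ _).trans ?_
        rw [abs_one]
        linarith
      calc _ ≤ 1 * |1 + inner ℝ e y| := mul_le_mul_of_nonneg_right φ.le_one (abs_nonneg _)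
        _ ≤ 2 := by rwa [one_mul]
  · intro y hy
    rw [φ.one_of_mem_closedBall (by rwa [mem_closedBall_zero_iff]), one_mul]

/-- A quadratic with curvature `A` centred at `x₀`, perturbed by a bump with profile `η`,
height `m` and width `h` at the same point. -/
noncomputable def perturbedQuadratic {d : ℕ} (η : Euc d → ℝ) (A m h : ℝ) (x₀ : Euc d) :
    Euc d → ℝ :=
  fun y => A / 2 * ‖y - x₀‖ ^ 2 + m * η (h⁻¹ • (y - x₀))

/-- The point at which the gradient of `perturbedQuadratic` vanishes. -/
noncomputable def criticalPoint {d : ℕ} (e : Euc d) (A m h : ℝ) (x₀ : Euc d) : Euc d :=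
  x₀ - (m / (h * A)) • e

section Perturbed

variable {d : ℕ} {e : Euc d} {η : Euc d → ℝ} {A m h : ℝ} {x₀ : Euc d}

open scoped ContDiff in
theorem contDiff_perturbedQuadratic (hη : IsBumpProfile e η) :
    ContDiff ℝ ∞ (perturbedQuadratic η A m h x₀) :=
  (contDiff_quadratic A x₀).add
    (contDiff_const.mul (hη.contDiff.comp (by fun_prop : ContDiff ℝ ∞ fun y => h⁻¹ • (y - x₀))))

/-- The bump contributes a remainder of order `m h⁻ᵞ ‖x' - x‖ᵞ`. -/
theorem abs_taylorRemainder_perturbedQuadratic_sub_le (hη : IsBumpProfile e η) (hh : 0 < h)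
    (hm : 0 ≤ m) {l : ℕ} {γ C : ℝ}
    (hC : ∀ x x', |taylorRemainder l η x x'| ≤ C * ‖x' - x‖ ^ γ) (x x' : Euc d) :
    |taylorRemainder l (perturbedQuadratic η A m h x₀) x x' -
      taylorRemainder l (fun y => A / 2 * ‖y - x₀‖ ^ 2) x x'| ≤
      m * C * h ^ (-γ) * ‖x' - x‖ ^ γ := by
  have hl : ContDiff ℝ l η := hη.contDiff.of_le (by exact_mod_cast le_top)
  have hg : ContDiff ℝ l fun y : Euc d => m * η (h⁻¹ • (y - x₀)) :=
    contDiff_const.mul (hl.comp (by fun_prop : ContDiff ℝ l fun y => h⁻¹ • (y - x₀)))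
  unfold perturbedQuadratic
  rw [taylorRemainder_add (contDiff_quadratic A x₀) hg,
    taylorRemainder_const_mul_comp_rescale hl, add_sub_cancel_left, abs_mul, abs_of_nonneg hm,
    mul_assoc, mul_assoc]
  refine mul_le_mul_of_nonneg_left ((hC _ _).trans (le_of_eq ?_)) hm
  rw [show h⁻¹ • (x' - x₀) - h⁻¹ • (x - x₀) = h⁻¹ • (x' - x) by module, norm_smul,
    Real.norm_of_nonneg (by positivity), Real.mul_rpow (by positivity) (by positivity),
    Real.inv_rpow hh.le, Real.rpow_neg hh.le]

/-- The curvature lost to the bump is at most of order `m h⁻²`. -/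
theorem strongConvexity_perturbedQuadratic (hη : IsBumpProfile e η) (hh : 0 < h) (hm : 0 ≤ m)
    {C α : ℝ} (hC : ∀ x x', |taylorRemainder 1 η x x'| ≤ C * ‖x' - x‖ ^ (2 : ℝ))
    (hα : α / 2 + m * C * h ^ (-2 : ℝ) ≤ A / 2) (x y : Euc d) :
    perturbedQuadratic η A m h x₀ x + fderiv ℝ (perturbedQuadratic η A m h x₀) x (y - x) +
      α / 2 * ‖x - y‖ ^ 2 ≤ perturbedQuadratic η A m h x₀ y := by
  have h1 := abs_taylorRemainder_perturbedQuadratic_sub_le (A := A) (x₀ := x₀) hη hh hm hC x y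
  rw [taylorRemainder_quadratic A x₀ x y 0, if_pos rfl, taylorRemainder_one, Real.rpow_two] at h1
  have h2 := (abs_le.1 h1).1
  rw [norm_sub_rev x y]
  nlinarith [sq_nonneg ‖y - x‖]

theorem isHolder_perturbedQuadratic (hη : IsBumpProfile e η) (hh : 0 < h) (hm : 0 ≤ m)
    {β L C : ℝ} (hβ : 2 ≤ β) (hA : 0 ≤ A)
    (hC : ∀ x x', |taylorRemainder (holderOrder β) η x x'| ≤ C * ‖x' - x‖ ^ β)
    (hL : m * C * h ^ (-β) ≤ L) (hL2 : β = 2 → A / 2 + m * C * h ^ (-β) ≤ L) :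
    IsHolder β L (perturbedQuadratic η A m h x₀) := by
  refine ⟨fun k _ => (contDiff_perturbedQuadratic hη).differentiable_iteratedFDeriv
    (by exact_mod_cast ENat.natCast_lt_top k), fun x x' => ?_⟩
  have h1 := abs_taylorRemainder_perturbedQuadratic_sub_le (A := A) (x₀ := x₀) hη hh hm hC x x'
  change |taylorRemainder (holderOrder β) _ x x'| ≤ _
  have hpow : 0 ≤ ‖x' - x‖ ^ β := Real.rpow_nonneg (norm_nonneg _) _
  rcases hβ.eq_or_lt with h2 | h2
  · have hord : holderOrder β = 0 + 1 := by
      rw [holderOrder, ← h2]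
      norm_num
    rw [hord, taylorRemainder_quadratic, if_pos rfl] at h1
    rw [hord]
    have hL' := hL2 h2.symm
    rw [← h2, Real.rpow_two] at h1 hpow ⊢
    rw [← h2] at hL'
    rw [abs_le] at h1 ⊢
    constructor <;> nlinarith [h1.1, h1.2, sq_nonneg ‖x' - x‖]
  · obtain ⟨l, hl⟩ : ∃ l, holderOrder β = l + 2 := by
      refine Nat.exists_eq_add_of_le' ?_
      have : 2 < ⌈β⌉₊ := Nat.lt_ceil.2 (by exact_mod_cast h2)
      unfold holderOrder
      omega
    rw [hl, show l + 2 = (l + 1) + 1 from rfl, taylorRemainder_quadratic, if_neg l.succ_ne_zero,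
      sub_zero] at h1
    rw [hl]
    exact h1.trans (mul_le_mul_of_nonneg_right hL hpow)

theorem norm_criticalPoint_sub (he : ‖e‖ = 1) (hh : 0 < h) (hm : 0 ≤ m) (hA : 0 < A) :
    ‖criticalPoint e A m h x₀ - x₀‖ = m / (h * A) := by
  rw [criticalPoint, sub_sub_cancel_left, norm_neg, norm_smul, he, mul_one,
    Real.norm_of_nonneg (by positivity)]

theorem norm_rescaled_criticalPoint (he : ‖e‖ = 1) (hh : 0 < h) (hm : 0 ≤ m) (hA : 0 < A)
    (hs : m / (h * A) < h / 2) : ‖h⁻¹ • (criticalPoint e A m h x₀ - x₀)‖ < 1 / 2 := by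
  rw [norm_smul, norm_criticalPoint_sub he hh hm hA, Real.norm_of_nonneg (by positivity),
    inv_mul_lt_iff₀ hh]
  linarith

theorem perturbedQuadratic_criticalPoint (hη : IsBumpProfile e η) (he : ‖e‖ = 1) (hh : 0 < h)
    (hm : 0 ≤ m) (hA : 0 < A) (hs : m / (h * A) < h / 2) :
    perturbedQuadratic η A m h x₀ (criticalPoint e A m h x₀) =
      m - m / 2 * (m / (h * A)) / h := by
  rw [perturbedQuadratic, hη.eq_affine _ (norm_rescaled_criticalPoint he hh hm hA hs).le,
    norm_criticalPoint_sub he hh hm hA, criticalPoint, sub_sub_cancel_left, inner_smul_right,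
    inner_neg_right, inner_smul_right, real_inner_self_eq_norm_sq, he]
  field_simp
  ring

theorem fderiv_perturbedQuadratic_criticalPoint (hη : IsBumpProfile e η) (he : ‖e‖ = 1)
    (hh : 0 < h) (hm : 0 ≤ m) (hA : 0 < A) (hs : m / (h * A) < h / 2) :
    fderiv ℝ (perturbedQuadratic η A m h x₀) (criticalPoint e A m h x₀) = 0 := by
  set x₁ := criticalPoint e A m h x₀ with hx₁
  have hev : perturbedQuadratic η A m h x₀ =ᶠ[nhds x₁] fun y =>
      A / 2 * ‖y - x₀‖ ^ 2 + m * (1 + inner ℝ e (h⁻¹ • (y - x₀))) := by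
    have hcont : Continuous fun y : Euc d => ‖h⁻¹ • (y - x₀)‖ := by fun_prop
    filter_upwards [hcont.continuousAt.eventually_lt continuousAt_const
      (norm_rescaled_criticalPoint he hh hm hA hs)] with y hy
    rw [perturbedQuadratic, hη.eq_affine _ hy.le]
  rw [hev.fderiv_eq]
  have h1 : HasFDerivAt (fun y : Euc d => y - x₀) (ContinuousLinearMap.id ℝ (Euc d)) x₁ :=
    (hasFDerivAt_id x₁).sub_const x₀
  have h2 : HasFDerivAt (fun y => A / 2 * ‖y - x₀‖ ^ 2 + m * (1 + inner ℝ e (h⁻¹ • (y - x₀))))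
      ((A / 2) • (2 • (innerSL ℝ (x₁ - x₀)).comp (ContinuousLinearMap.id ℝ (Euc d))) +
        m • (innerSL ℝ e).comp (h⁻¹ • ContinuousLinearMap.id ℝ (Euc d))) x₁ :=
    (h1.norm_sq.const_mul (A / 2)).add
      ((((innerSL ℝ e).hasFDerivAt.comp x₁ (h1.const_smul h⁻¹)).const_add 1).const_mul m)
  rw [h2.fderiv]
  ext v
  simp [hx₁, criticalPoint]
  field_simp
  ring

/-- Around its critical point the perturbed quadratic grows at least quadratically, on the whole
space. -/
theorem quadratic_growth_perturbedQuadratic (hη : IsBumpProfile e η) (he : ‖e‖ = 1) (hh : 0 < h)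
    (hm : 0 ≤ m) (hA : 0 < A) (hs : m / (h * A) < h / 2) {C α : ℝ}
    (hC : ∀ x x', |taylorRemainder 1 η x x'| ≤ C * ‖x' - x‖ ^ (2 : ℝ))
    (hα : α / 2 + m * C * h ^ (-2 : ℝ) ≤ A / 2) (y : Euc d) :
    perturbedQuadratic η A m h x₀ (criticalPoint e A m h x₀) +
      α / 2 * ‖y - criticalPoint e A m h x₀‖ ^ 2 ≤ perturbedQuadratic η A m h x₀ y := by
  have := strongConvexity_perturbedQuadratic (x₀ := x₀) hη hh hm hC hα
    (criticalPoint e A m h x₀) y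
  rw [fderiv_perturbedQuadratic_criticalPoint hη he hh hm hA hs, norm_sub_rev] at this
  simpa using this

end Perturbed

/-- A function that grows quadratically around a point of `Θ` has that point as its
minimizer on `Θ`. -/
theorem minimizer_minValue_of_quadratic_growth {d : ℕ} {Θ : Set (Euc d)} {f : Euc d → ℝ}
    {α : ℝ} (hα : 0 < α) {x₁ : Euc d} (hx₁ : x₁ ∈ Θ)
    (hf : ∀ y, f x₁ + α / 2 * ‖y - x₁‖ ^ 2 ≤ f y) :
    IsMinOn f Θ x₁ ∧ minimizer Θ f = x₁ ∧ minValue Θ f = f x₁ := by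
  have hle : ∀ y, f x₁ ≤ f y := fun y => by
    have := hf y
    have : 0 ≤ α / 2 * ‖y - x₁‖ ^ 2 := by positivity
    linarith
  have hmin : IsMinOn f Θ x₁ := fun y _ => hle y
  refine ⟨hmin, ?_, ?_⟩
  · have hspec : minimizer Θ f ∈ Θ ∧ IsMinOn f Θ (minimizer Θ f) :=
      Classical.epsilon_spec (p := fun x => x ∈ Θ ∧ IsMinOn f Θ x) ⟨x₁, hx₁, hmin⟩
    have h1 : f (minimizer Θ f) ≤ f x₁ := hspec.2 hx₁
    have h2 := hf (minimizer Θ f)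
    have h3 : ‖minimizer Θ f - x₁‖ ^ 2 ≤ 0 := by nlinarith
    have h4 : ‖minimizer Θ f - x₁‖ = 0 := by
      nlinarith [norm_nonneg (minimizer Θ f - x₁)]
    exact sub_eq_zero.1 (norm_eq_zero.1 h4)
  · exact IsLeast.csInf_eq ⟨mem_image_of_mem f hx₁, by
      rintro _ ⟨y, -, rfl⟩
      exact hle y⟩

/-! ### Locating the bump -/

/-- Averaging the design probability of a ball over its centre shows that some centre has a
design probability of the order of the volume, with a constant that is free of the density. -/
theorem exists_measure_ball_le {d : ℕ} (Q : Measure (Euc d)) [IsProbabilityMeasure Q]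
    (z : Euc d) {r h : ℝ} (hr : 0 < r) (hh : 0 < h) :
    ∃ x ∈ Metric.ball z r, Q (Metric.ball x h) ≤ ENNReal.ofReal ((h / r) ^ d) := by
  have hvol : ∀ (y : Euc d) {s : ℝ}, 0 < s → (volume : Measure (Euc d)) (Metric.ball y s) =
      ENNReal.ofReal (s ^ d) * volume (Metric.ball (0 : Euc d) 1) := fun y s hs => by
    rw [Measure.addHaar_ball_of_pos _ _ hs, finrank_euclideanSpace_fin]
  have hopen : IsOpen {p : Euc d × Euc d | dist p.2 p.1 < h} :=
    isOpen_lt (continuous_snd.dist continuous_fst) continuous_const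
  have hmeas : Measurable fun x : Euc d => Q (Metric.ball x h) :=
    measurable_measure_prodMk_left hopen.measurableSet
  have htot : ∫⁻ x, Q (Metric.ball x h) = volume (Metric.ball (0 : Euc d) h) := by
    have h1 := Measure.prod_apply (μ := (volume : Measure (Euc d))) (ν := Q) hopen.measurableSet
    rw [Measure.prod_apply_symm hopen.measurableSet] at h1
    have h2 : ∀ y : Euc d, (volume : Measure (Euc d))
        ((fun x => (x, y)) ⁻¹' {p : Euc d × Euc d | dist p.2 p.1 < h}) =
        volume (Metric.ball (0 : Euc d) h) := fun y => by
      rw [hvol 0 hh, ← hvol y hh]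
      congr 1
      ext x
      simp [dist_comm]
    rw [lintegral_congr h2, lintegral_const, measure_univ, mul_one] at h1
    exact h1.symm
  obtain ⟨x, hx, hle⟩ := exists_le_setLAverage (μ := (volume : Measure (Euc d)))
    (Metric.measure_ball_pos volume z hr).ne' measure_ball_lt_top.ne hmeas.aemeasurable
  refine ⟨x, hx, hle.trans ?_⟩
  rw [setLAverage_eq]
  refine ENNReal.div_le_of_le_mul ?_
  refine (setLIntegral_le_lintegral _ _).trans (le_of_eq ?_)
  rw [htot, hvol 0 hh, hvol z hr, ← mul_assoc, ← ENNReal.ofReal_mul (by positivity), div_pow,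
    div_mul_cancel₀ _ (by positivity)]

/-! ### The pair of hypotheses -/

theorem perturbedQuadratic_mem_regressionClass {d : ℕ} {Θ : Set (Euc d)}
    (hΘ : Bornology.IsBounded Θ) {e : Euc d} {η : Euc d → ℝ} {A m h : ℝ} {x₀ : Euc d}
    (hη : IsBumpProfile e η) (he : ‖e‖ = 1) (hh : 0 < h) (hm : 0 ≤ m) (hA : 0 < A)
    (hs : m / (h * A) < h / 2) {α β L M C C' : ℝ} (hβ : 2 ≤ β) (hα : 0 < α)
    (hC : ∀ x x', |taylorRemainder 1 η x x'| ≤ C * ‖x' - x‖ ^ (2 : ℝ))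
    (hC' : ∀ x x', |taylorRemainder (holderOrder β) η x x'| ≤ C' * ‖x' - x‖ ^ β)
    (hcurv : α / 2 + m * C * h ^ (-2 : ℝ) ≤ A / 2)
    (hL : m * C' * h ^ (-β) ≤ L) (hL2 : β = 2 → A / 2 + m * C' * h ^ (-β) ≤ L)
    (hball : Metric.closedBall x₀ h ⊆ Θ)
    (hM : A / 2 * (1 + Metric.diam Θ) ^ 2 + 2 * m ≤ M) :
    criticalPoint e A m h x₀ ∈ Θ ∧
      perturbedQuadratic η A m h x₀ ∈ regressionClass Θ β α L M := by
  have hcp : criticalPoint e A m h x₀ ∈ Θ := by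
    refine hball ?_
    rw [mem_closedBall_iff_norm, norm_criticalPoint_sub he hh hm hA]
    linarith
  have hx₀ : x₀ ∈ Θ := hball (Metric.mem_closedBall_self hh.le)
  refine ⟨hcp, ⟨_, hcp, (minimizer_minValue_of_quadratic_growth hα hcp
    (quadratic_growth_perturbedQuadratic hη he hh hm hA hs hC hcurv)).1⟩,
    isHolder_perturbedQuadratic hη hh hm hβ hA.le hC' hL hL2, fun x _ y _ => ?_, ?_⟩
  · have h1 := strongConvexity_perturbedQuadratic (x₀ := x₀) hη hh hm hC hcurv x y
    rwa [gradient, InnerProductSpace.toDual_symm_apply]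
  · rintro x ⟨θ, hθ, y, hy, rfl⟩
    have h1 : ‖θ + y - x₀‖ ≤ 1 + Metric.diam Θ := by
      have h2 := Metric.dist_le_diam_of_mem hΘ hθ hx₀
      rw [dist_eq_norm] at h2
      calc ‖θ + y - x₀‖ = ‖(θ - x₀) + y‖ := by congr 1; module
        _ ≤ ‖θ - x₀‖ + ‖y‖ := norm_add_le _ _
        _ ≤ _ := by linarith
    have h3 : |A / 2 * ‖θ + y - x₀‖ ^ 2| ≤ A / 2 * (1 + Metric.diam Θ) ^ 2 := by
      rw [abs_of_nonneg (by positivity)]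
      gcongr
    have h4 : |m * η (h⁻¹ • (θ + y - x₀))| ≤ 2 * m := by
      rw [abs_mul, abs_of_nonneg hm, mul_comm]
      exact mul_le_mul_of_nonneg_right (hη.abs_le _) hm
    exact (abs_add_le _ _).trans (by linarith)

/-- The choice of the constants. The curvature of the quadratic is `c α` with `1 < c < 1 / κ`,
which leaves room for the bump both in the strong convexity condition and, for `β = 2`, in the
Hölder condition; `r` bounds the height `m ≤ r h ^ β` of the bump, and `a` the curvature
`α ≥ a h ^ (β - 2)` below which a bump of that height would spoil convexity. -/
theorem exists_constants {β L v₀ M₀ κ C C' R : ℝ} (hL : 0 < L) (hv₀ : 0 < v₀) (hM₀ : 0 < M₀)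
    (hκ₀ : 0 < κ) (hκ₁ : κ < 1) (hC : 0 ≤ C) (hC' : 0 ≤ C') (hR : 0 < R) (hβ : 2 ≤ β) :
    ∃ c r a : ℝ, 1 < c ∧ c < 2 ∧ 0 < r ∧ 0 < a ∧ 2 * r ≤ v₀ ∧ a ≤ 2 * κ * L ∧ a * R ^ 2 ≤ M₀ ∧
      ∀ h m α M : ℝ, 0 < h → h ≤ 1 → 0 ≤ m → m ≤ r * h ^ β → a * h ^ (β - 2) ≤ α →
        (β = 2 → α ≤ 2 * κ * L) → M₀ ≤ M → α * R ^ 2 ≤ M →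
        m / (h * (c * α)) < h / 2 ∧ α / 2 + m * C * h ^ (-2 : ℝ) ≤ c * α / 2 ∧
        m * C' * h ^ (-β) ≤ L ∧ (β = 2 → c * α / 2 + m * C' * h ^ (-β) ≤ L) ∧
        c * α / 2 * R ^ 2 + 2 * m ≤ M := by
  obtain ⟨c, hc1, hc2, hcκ⟩ : ∃ c : ℝ, 1 < c ∧ c < 2 ∧ c * κ < 1 := by
    refine ⟨2 / (1 + κ), ?_, ?_, ?_⟩
    · rw [lt_div_iff₀ (by linarith)]; linarith
    · rw [div_lt_iff₀ (by linarith)]; linarith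
    · rw [div_mul_eq_mul_div, div_lt_one (by linarith)]; linarith
  obtain ⟨D, hD3, hDC⟩ : ∃ D : ℝ, 3 ≤ D ∧ 2 * C ≤ D * (c - 1) := by
    refine ⟨max 3 (2 * C / (c - 1)), le_max_left _ _, ?_⟩
    rw [← div_le_iff₀ (by linarith)]
    exact le_max_right _ _
  obtain ⟨r, hr, hr1, hr2, hr3, hr4, hr5⟩ : ∃ r : ℝ, 0 < r ∧ r * C' ≤ (1 - c * κ) * L ∧
      2 * r ≤ v₀ ∧ 2 * r ≤ (1 - c / 2) * M₀ ∧ r * D * R ^ 2 ≤ M₀ ∧ r * D ≤ 2 * κ * L := by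
    have hs : ∀ b t : ℝ, 0 ≤ b → 0 < t → ∀ᶠ r in nhdsWithin (0 : ℝ) (Ioi 0), r * b ≤ t := by
      intro b t hb ht
      have : Filter.Tendsto (fun r : ℝ => r * b) (nhdsWithin 0 (Ioi 0)) (nhds (0 * b)) :=
        ((continuous_id.mul continuous_const).tendsto 0).mono_left nhdsWithin_le_nhds
      rw [zero_mul] at this
      exact (this.eventually_lt_const ht).mono fun _ h => h.le
    have hev := (hs C' ((1 - c * κ) * L) hC' (mul_pos (by linarith) hL)).and
      ((hs 2 v₀ (by norm_num) hv₀).and ((hs 2 ((1 - c / 2) * M₀) (by norm_num)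
      (mul_pos (by linarith) hM₀)).and ((hs (D * R ^ 2) M₀ (by positivity) hM₀).and
      (hs D (2 * κ * L) (by linarith) (by positivity)))))
    obtain ⟨r, ⟨h1, h2, h3, h4, h5⟩, h6⟩ := (hev.and self_mem_nhdsWithin).exists
    exact ⟨r, h6, h1, by linarith, by linarith, by linarith, h5⟩
  refine ⟨c, r, r * D, hc1, hc2, hr, by positivity, hr2, hr5, hr4, ?_⟩
  intro h m α M hh hh1 hm hmr hα hα2 hM hαM
  have hP : 0 < h ^ (β - 2) := Real.rpow_pos_of_pos hh _
  have hQ : 0 < h ^ β := Real.rpow_pos_of_pos hh _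
  have hQ1 : h ^ β ≤ 1 := Real.rpow_le_one hh.le hh1 (by linarith)
  have hPQ : h ^ β = h ^ (β - 2) * h ^ 2 := by
    rw [← Real.rpow_two, ← Real.rpow_add hh]
    congr 1
    ring
  have hα0 : 0 < α := lt_of_lt_of_le (by positivity) hα
  have hm2 : m * h ^ (-2 : ℝ) ≤ r * h ^ (β - 2) := by
    rw [Real.rpow_neg hh.le, Real.rpow_two, ← div_eq_mul_inv, div_le_iff₀ (by positivity)]
    rw [hPQ] at hmr
    linarith
  have hmβ : m * h ^ (-β) ≤ r := by
    rw [Real.rpow_neg hh.le, ← div_eq_mul_inv, div_le_iff₀ hQ]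
    exact hmr
  have hmC' : m * C' * h ^ (-β) ≤ (1 - c * κ) * L := by
    rw [mul_right_comm]
    exact (mul_le_mul_of_nonneg_right hmβ hC').trans hr1
  have hrP : r * 3 * h ^ (β - 2) ≤ α := le_trans (by gcongr) hα
  refine ⟨?_, ?_, ?_, ?_, ?_⟩
  · rw [div_lt_iff₀ (by positivity)]
    have h1 : r * h ^ β * 3 ≤ α * h ^ 2 := by
      rw [hPQ]
      linarith [mul_le_mul_of_nonneg_right hrP (sq_nonneg h)]
    have h2 : α * h ^ 2 ≤ c * (α * h ^ 2) := le_mul_of_one_le_left (by positivity) hc1.le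
    have h3 := mul_pos hr hQ
    linarith
  · have h1 : m * C * h ^ (-2 : ℝ) ≤ r * h ^ (β - 2) * C := by
      rw [mul_right_comm]
      exact mul_le_mul_of_nonneg_right hm2 hC
    have h2 : r * h ^ (β - 2) * (2 * C) ≤ r * h ^ (β - 2) * (D * (c - 1)) :=
      mul_le_mul_of_nonneg_left hDC (by positivity)
    have h3 : r * D * h ^ (β - 2) * (c - 1) ≤ α * (c - 1) :=
      mul_le_mul_of_nonneg_right hα (by linarith)
    linarith
  · have := mul_pos (mul_pos (by linarith : 0 < c) hκ₀) hL
    linarith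
  · intro h2
    have := mul_le_mul_of_nonneg_left (hα2 h2) (by linarith : 0 ≤ c)
    linarith
  · have h1 : c / 2 * (α * R ^ 2) ≤ c / 2 * M := mul_le_mul_of_nonneg_left hαM (by linarith)
    have h2 : (1 - c / 2) * M₀ ≤ (1 - c / 2) * M := mul_le_mul_of_nonneg_left hM (by linarith)
    have h3 : 2 * m ≤ 2 * r := by
      linarith [mul_le_of_le_one_right hr.le hQ1]
    linarith

theorem regressionClass_anti {d : ℕ} {Θ : Set (Euc d)} {β α α' L M : ℝ} (h : α ≤ α') :
    regressionClass Θ β α' L M ⊆ regressionClass Θ β α L M := fun f hf =>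
  ⟨hf.attains, hf.holder, fun x hx y hy => le_trans (by gcongr) (hf.stronglyConvex x hx y hy),
    hf.bounded⟩

/-- Two regression functions that are hard to distinguish from passive observations with design
distribution `Q` and whose minimizers and minimum values are far apart. The parameter `γ` is the
common modulus of quadratic growth, `s` and `t` are the separations of the minimizers and of the
minimum values; the functions differ only on `S`, by at most `V`, and `τ` bounds the information
`I V² Q(S)` per observation. -/
structure IsHypothesisPair {d : ℕ} (Θ : Set (Euc d)) (F : Set (Euc d → ℝ)) (Q : Measure (Euc d))
    (I v₀ γ s t τ V : ℝ) (S : Set (Euc d)) (f g : Euc d → ℝ) : Prop where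
  mem_left : f ∈ F
  mem_right : g ∈ F
  measurable_left : Measurable f
  measurable_right : Measurable g
  growth_left : ∀ y, minValue Θ f + γ / 2 * ‖y - minimizer Θ f‖ ^ 2 ≤ f y
  growth_right : ∀ y, minValue Θ g + γ / 2 * ‖y - minimizer Θ g‖ ^ 2 ≤ g y
  minimizer_sep : s ≤ ‖minimizer Θ f - minimizer Θ g‖
  minValue_sep : t ≤ |minValue Θ f - minValue Θ g|
  measurableSet : MeasurableSet S
  eq_of_notMem : ∀ x ∉ S, g x = f x
  abs_sub_le : ∀ x, |g x - f x| ≤ V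
  le_noise_range : V ≤ v₀
  information_le : ENNReal.ofReal (I * V ^ 2) * Q S ≤ ENNReal.ofReal τ

/-- The two hypotheses of the lower bound: a quadratic, and the same quadratic with a bump of
width `h` and height of order `h ^ β`, placed where the design has probability `O(h ^ d)`. If `α`
is too small for the bump to be compatible with convexity, `α` is first increased to the order
of `h ^ (β - 2)`. -/
theorem exists_isHypothesisPair {d : ℕ} (hd : 0 < d) {Θ : Set (Euc d)}
    (hΘ : Bornology.IsBounded Θ) (hΘi : (interior Θ).Nonempty) {β L I v₀ M₀ κ : ℝ} (hβ : 2 ≤ β)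
    (hL : 0 < L) (hI : 0 < I) (hv₀ : 0 < v₀) (hM₀ : 0 < M₀) (hκ₀ : 0 < κ) (hκ₁ : κ < 1) :
    ∃ r a h₀ K : ℝ, 0 < r ∧ 0 < a ∧ 0 < h₀ ∧ 0 < K ∧
      ∀ h α M : ℝ, 0 < h → h ≤ h₀ → 0 < α → (β = 2 → α ≤ 2 * κ * L) → M₀ ≤ M →
        α * (1 + Metric.diam Θ) ^ 2 ≤ M → ∀ (Q : Measure (Euc d)) [IsProbabilityMeasure Q],
        ∃ V S f g, IsHypothesisPair Θ (regressionClass Θ β α L M) Q I v₀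
          (max α (a * h ^ (β - 2))) (r * h ^ (β - 1) / max α (a * h ^ (β - 2))) (r * h ^ β)
          (K * h ^ (2 * β + d)) V S f g := by
  let e : Euc d := EuclideanSpace.single ⟨0, hd⟩ 1
  have he : ‖e‖ = 1 := by simp [e]
  obtain ⟨η, hη⟩ := exists_isBumpProfile he
  obtain ⟨C, hC0, hC⟩ := exists_abs_taylorRemainder_le hη.contDiff hη.hasCompactSupport
    (l := 1) (γ := 2) (by norm_num) (by norm_num)
  have hord : ((holderOrder β : ℕ) : ℝ) ≤ β ∧ β ≤ (holderOrder β : ℕ) + 1 := by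
    have h1 : 1 ≤ ⌈β⌉₊ := Nat.one_le_ceil_iff.2 (by linarith)
    have h2 := Nat.ceil_lt_add_one (show 0 ≤ β by linarith)
    have h3 := Nat.le_ceil β
    rw [holderOrder, Nat.cast_sub h1, Nat.cast_one]
    constructor <;> linarith
  obtain ⟨C', hC0', hC'⟩ := exists_abs_taylorRemainder_le hη.contDiff hη.hasCompactSupport
    hord.1 hord.2
  have hR : 0 < 1 + Metric.diam Θ := by linarith [Metric.diam_nonneg (s := Θ)]
  obtain ⟨c, r, a, hc1, hc2, hr, ha, hrv, haL, haM, hconst⟩ :=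
    exists_constants (β := β) hL hv₀ hM₀ hκ₀ hκ₁ hC0 hC0' hR hβ
  obtain ⟨z, hz⟩ := hΘi
  obtain ⟨ρ, hρ, hzρ⟩ := Metric.isOpen_iff.1 isOpen_interior z hz
  refine ⟨r / 2, a, min 1 (ρ / 2) / 2, I * (2 * r) ^ 2 * (2 / ρ) ^ d, by positivity, ha,
    by positivity, by positivity, ?_⟩
  intro h α M hh hhh hα hα2 hM hαM Q _
  have hh1 : h ≤ 1 := by
    have := min_le_left 1 (ρ / 2); linarith
  have hhρ : h < ρ / 2 := by
    have := min_le_right 1 (ρ / 2); linarith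
  set α' := max α (a * h ^ (β - 2)) with hα'
  have hαα' : α ≤ α' := le_max_left _ _
  have hα'0 : 0 < α' := hα.trans_le hαα'
  have hP1 : h ^ (β - 2) ≤ 1 := Real.rpow_le_one hh.le hh1 (by linarith)
  have haP : a * h ^ (β - 2) ≤ a := mul_le_of_le_one_right ha.le hP1
  have hα2' : β = 2 → α' ≤ 2 * κ * L := fun h2 => max_le (hα2 h2) (haP.trans haL)
  have hαM' : α' * (1 + Metric.diam Θ) ^ 2 ≤ M := by
    rcases max_choice α (a * h ^ (β - 2)) with h1 | h1 <;> rw [hα', h1]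
    · exact hαM
    · exact (mul_le_mul_of_nonneg_right haP (by positivity)).trans (haM.trans hM)
  obtain ⟨x₀, hx₀, hQ⟩ := exists_measure_ball_le Q z (half_pos hρ) hh
  have hball : Metric.closedBall x₀ h ⊆ Θ := by
    refine (fun y hy => interior_subset (hzρ ?_))
    rw [Metric.mem_ball] at hx₀ ⊢
    rw [Metric.mem_closedBall] at hy
    linarith [dist_triangle y x₀ z]
  have hQβ : 0 < h ^ β := Real.rpow_pos_of_pos hh _
  have hA : 0 < c * α' := by positivity
  -- Both hypotheses belong to the same family: the unperturbed quadratic has a bump of height `0`.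
  have main : ∀ m : ℝ, 0 ≤ m → m ≤ r * h ^ β →
      perturbedQuadratic η (c * α') m h x₀ ∈ regressionClass Θ β α L M ∧
      (∀ y, perturbedQuadratic η (c * α') m h x₀ (criticalPoint e (c * α') m h x₀) +
        α' / 2 * ‖y - criticalPoint e (c * α') m h x₀‖ ^ 2 ≤
          perturbedQuadratic η (c * α') m h x₀ y) ∧
      minimizer Θ (perturbedQuadratic η (c * α') m h x₀) = criticalPoint e (c * α') m h x₀ ∧
      minValue Θ (perturbedQuadratic η (c * α') m h x₀) =
        perturbedQuadratic η (c * α') m h x₀ (criticalPoint e (c * α') m h x₀) := by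
    intro m hm hmr
    obtain ⟨h1, h2, h3, h4, h5⟩ := hconst h m α' M hh hh1 hm hmr (le_max_right _ _) hα2' hM hαM'
    obtain ⟨h6, h7⟩ := perturbedQuadratic_mem_regressionClass hΘ hη he hh hm hA h1 hβ hα'0 hC hC'
      h2 h3 h4 hball h5
    have h8 := quadratic_growth_perturbedQuadratic (x₀ := x₀) hη he hh hm hA h1 hC h2
    exact ⟨regressionClass_anti hαα' h7, h8,
      (minimizer_minValue_of_quadratic_growth hα'0 h6 h8).2⟩
  have hm0 : 0 ≤ r * h ^ β := by positivity
  obtain ⟨f_mem, f_growth, f_min, f_val⟩ := main 0 le_rfl hm0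
  obtain ⟨g_mem, g_growth, g_min, g_val⟩ := main (r * h ^ β) hm0 le_rfl
  have hs0 := (hconst h 0 α' M hh hh1 le_rfl hm0 (le_max_right _ _) hα2' hM hαM').1
  have hs1 := (hconst h _ α' M hh hh1 hm0 le_rfl (le_max_right _ _) hα2' hM hαM').1
  have hcp : criticalPoint e (c * α') 0 h x₀ = x₀ := by simp [criticalPoint]
  have hsub : ∀ x, perturbedQuadratic η (c * α') (r * h ^ β) h x₀ x -
      perturbedQuadratic η (c * α') 0 h x₀ x = r * h ^ β * η (h⁻¹ • (x - x₀)) := fun x => by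
    simp [perturbedQuadratic]
  refine ⟨2 * (r * h ^ β), Metric.ball x₀ h, perturbedQuadratic η (c * α') 0 h x₀,
    perturbedQuadratic η (c * α') (r * h ^ β) h x₀, f_mem, g_mem,
    (contDiff_perturbedQuadratic hη).continuous.measurable,
    (contDiff_perturbedQuadratic hη).continuous.measurable, ?_, ?_, ?_, ?_, measurableSet_ball,
    ?_, ?_, ?_, ?_⟩
  · rwa [f_min, f_val]
  · rwa [g_min, g_val]
  · rw [f_min, g_min, hcp, norm_sub_rev, norm_criticalPoint_sub he hh hm0 hA,
      Real.rpow_sub_one hh.ne']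
    have : r / 2 * (h ^ β / h) / α' = r * h ^ β / (h * (2 * α')) := by field_simp
    rw [this]
    gcongr
  · rw [f_val, g_val, perturbedQuadratic_criticalPoint hη he hh hm0 hA hs1,
      perturbedQuadratic_criticalPoint hη he hh le_rfl hA hs0, abs_sub_comm]
    refine le_trans ?_ (le_abs_self _)
    have h1 : r * h ^ β / 2 * (r * h ^ β / (h * (c * α'))) / h ≤ r * h ^ β / 2 := by
      rw [div_le_iff₀ hh]
      exact mul_le_mul_of_nonneg_left (by linarith) (by positivity)
    simp only [zero_div, zero_mul, sub_zero]
    linarith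
  · intro x hx
    rw [← sub_eq_zero, hsub, hη.eq_zero, mul_zero]
    rw [norm_smul, Real.norm_of_nonneg (by positivity), le_inv_mul_iff₀ hh, mul_one]
    rwa [mem_ball_iff_norm, not_lt] at hx
  · intro x
    rw [hsub, abs_mul, abs_of_nonneg hm0, mul_comm]
    exact mul_le_mul_of_nonneg_right (hη.abs_le _) hm0
  · have : r * h ^ β ≤ r := mul_le_of_le_one_right hr.le (Real.rpow_le_one hh.le hh1 (by linarith))
    linarith
  · refine (mul_le_mul_right hQ _).trans ?_
    rw [← ENNReal.ofReal_mul (by positivity)]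
    refine ENNReal.ofReal_le_ofReal (le_of_eq ?_)
    rw [Real.rpow_add hh, Real.rpow_natCast, two_mul β, Real.rpow_add hh]
    have : h / (ρ / 2) = 2 / ρ * h := by field_simp
    rw [this, mul_pow]
    ring

/-! ### From testing to minimax risks -/

theorem exp_neg_two_mul_le_one_sub {τ : ℝ} (h0 : 0 ≤ τ) (h1 : τ ≤ 1 / 2) :
    Real.exp (-(2 * τ)) ≤ 1 - τ := by
  rw [Real.exp_neg, inv_le_comm₀ (Real.exp_pos _) (by linarith)]
  refine le_trans ?_ (Real.add_one_le_exp _)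
  rw [inv_le_iff_one_le_mul₀ (by linarith)]
  nlinarith

namespace IsHypothesisPair

variable {d n : ℕ} {Ω : Type u} [MeasurableSpace Ω] {μ : Measure Ω} [IsProbabilityMeasure μ]
  {X : Fin n → Ω → Euc d} {ξ : Fin n → Ω → ℝ} {pξ : ℝ → ℝ} {Θ : Set (Euc d)}
  {F : Set (Euc d → ℝ)} {Q : Measure (Euc d)} {I v₀ γ s t τ V : ℝ} {S : Set (Euc d)}
  {f g : Euc d → ℝ}

/-- No test separates the two hypotheses of a pair well if `n τ` is bounded. -/
theorem exp_le_error_add_error (hp : IsHypothesisPair Θ F Q I v₀ γ s t τ V S f g) (hn : 1 ≤ n)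
    (hs : IsPassiveSample μ X ξ pξ) (hI : 0 ≤ I) (hreg : HellingerRegular I v₀ pξ)
    (hQ : ∀ i, μ.map (X i) = Q) (hτ0 : 0 ≤ τ) (hτ : τ ≤ 1 / 2)
    {A : Set (Fin n → Euc d × ℝ)} (hA : MeasurableSet A) :
    ENNReal.ofReal (Real.exp (-(2 * (n * τ))) / 2) ≤
      μ {ω | sampleData X ξ f ω ∈ A} + μ {ω | sampleData X ξ g ω ∈ Aᶜ} := by
  refine le_trans ?_ (two_point_testing hn hs hI hreg hQ hp.measurable_left hp.measurable_right
    hp.le_noise_range hp.abs_sub_le hp.measurableSet hp.eq_of_notMem hA)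
  have h1 : ENNReal.ofReal (Real.exp (-(2 * τ))) ≤ 1 - ENNReal.ofReal (I * V ^ 2) * Q S := by
    calc _ ≤ ENNReal.ofReal (1 - τ) :=
          ENNReal.ofReal_le_ofReal (exp_neg_two_mul_le_one_sub hτ0 hτ)
      _ = 1 - ENNReal.ofReal τ := by rw [ENNReal.ofReal_sub _ hτ0, ENNReal.ofReal_one]
      _ ≤ _ := tsub_le_tsub_left hp.information_le _
  have h2 : Real.exp (-(2 * (n * τ))) = Real.exp (-(2 * τ)) ^ n := by
    rw [← Real.exp_nat_mul]
    congr 1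
    ring
  rw [h2, div_eq_inv_mul, ENNReal.ofReal_mul (by norm_num), ENNReal.ofReal_pow (Real.exp_pos _).le,
    ENNReal.ofReal_inv_of_pos (by norm_num), ENNReal.ofReal_ofNat]
  gcongr

/-- Reduction of estimation to testing: if a loss is at least `δ` whenever the estimate misses the
true parameter by half the separation of the two parameters, then the larger of the two risks is
bounded from below. -/
theorem le_max_risk (hp : IsHypothesisPair Θ F Q I v₀ γ s t τ V S f g) (hn : 1 ≤ n)
    (hs : IsPassiveSample μ X ξ pξ) (hI : 0 ≤ I) (hreg : HellingerRegular I v₀ pξ)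
    (hQ : ∀ i, μ.map (X i) = Q) (hτ0 : 0 ≤ τ) (hτ : τ ≤ 1 / 2)
    {E : Type*} [NormedAddCommGroup E] [MeasurableSpace E] [BorelSpace E]
    {T : (Fin n → Euc d × ℝ) → E} (hT : Measurable T) {θ₀ θ₁ : E} {sep δ : ℝ}
    (hsep : sep ≤ ‖θ₀ - θ₁‖) {ℓ₀ ℓ₁ : E → ℝ} (hδ : 0 ≤ δ)
    (h₀ : ∀ z, sep / 2 ≤ ‖z - θ₀‖ → δ ≤ ℓ₀ z) (h₁ : ∀ z, sep / 2 ≤ ‖z - θ₁‖ → δ ≤ ℓ₁ z) :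
    ENNReal.ofReal (δ * (Real.exp (-(2 * (n * τ))) / 4)) ≤
        ∫⁻ ω, ENNReal.ofReal (ℓ₀ (T (sampleData X ξ f ω))) ∂μ ∨
      ENNReal.ofReal (δ * (Real.exp (-(2 * (n * τ))) / 4)) ≤
        ∫⁻ ω, ENNReal.ofReal (ℓ₁ (T (sampleData X ξ g ω))) ∂μ := by
  have hball : MeasurableSet {z : E | sep / 2 ≤ ‖z - θ₀‖} :=
    (isClosed_le continuous_const (continuous_id.sub continuous_const).norm).measurableSet
  have hA : MeasurableSet (T ⁻¹' {z | sep / 2 ≤ ‖z - θ₀‖}) := hT hball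
  have htest := hp.exp_le_error_add_error hn hs hI hreg hQ hτ0 hτ hA
  have hdata : ∀ {φ : Euc d → ℝ}, Measurable φ → Measurable (sampleData X ξ φ) := fun hφ =>
    measurable_pi_lambda _ fun i => (hs.measurable_design i).prodMk
      ((hφ.comp (hs.measurable_design i)).add (hs.measurable_noise i))
  have hmark : ∀ {φ : Euc d → ℝ}, Measurable φ → ∀ {C : Set (Fin n → Euc d × ℝ)},
      MeasurableSet C → ∀ {ℓ : E → ℝ}, (∀ y ∈ C, δ ≤ ℓ (T y)) →
      ENNReal.ofReal δ * μ {ω | sampleData X ξ φ ω ∈ C} ≤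
        ∫⁻ ω, ENNReal.ofReal (ℓ (T (sampleData X ξ φ ω))) ∂μ := by
    intro φ hφ C hC ℓ hℓ
    have hCm : MeasurableSet {ω | sampleData X ξ φ ω ∈ C} := hdata hφ hC
    rw [← lintegral_indicator_const hCm]
    refine lintegral_mono fun ω => ?_
    refine indicator_le' (fun ω hω => ?_) (fun ω _ => zero_le (a := ENNReal.ofReal (ℓ (T (sampleData X ξ φ ω))))) ω
    exact ENNReal.ofReal_le_ofReal (hℓ _ hω)
  have h2 : ENNReal.ofReal (Real.exp (-(2 * (n * τ))) / 2) =
      ENNReal.ofReal (Real.exp (-(2 * (n * τ))) / 4) +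
        ENNReal.ofReal (Real.exp (-(2 * (n * τ))) / 4) := by
    rw [← ENNReal.ofReal_add (by positivity) (by positivity)]
    congr 1
    ring
  rw [h2] at htest
  rw [ENNReal.ofReal_mul hδ]
  rcases le_or_gt (ENNReal.ofReal (Real.exp (-(2 * (n * τ))) / 4))
    (μ {ω | sampleData X ξ f ω ∈ T ⁻¹' {z | sep / 2 ≤ ‖z - θ₀‖}}) with hle | hlt
  · left
    exact (mul_le_mul_right hle _).trans (hmark hp.measurable_left hA fun y hy => h₀ _ hy)
  · right
    have hle : ENNReal.ofReal (Real.exp (-(2 * (n * τ))) / 4) ≤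
        μ {ω | sampleData X ξ g ω ∈ (T ⁻¹' {z | sep / 2 ≤ ‖z - θ₀‖})ᶜ} := by
      by_contra hcon
      exact absurd htest (not_le.2 (ENNReal.add_lt_add hlt (not_le.1 hcon)))
    refine (mul_le_mul_right hle _).trans (hmark hp.measurable_right hA.compl fun y hy => h₁ _ ?_)
    have hy' : ‖T y - θ₀‖ < sep / 2 := not_le.1 hy
    have := norm_sub_le_norm_sub_add_norm_sub θ₀ (T y) θ₁
    rw [norm_sub_rev θ₀ (T y)] at this
    linarith

theorem le_minimaxRiskMinimizer (hp : IsHypothesisPair Θ F Q I v₀ γ s t τ V S f g) (hn : 1 ≤ n)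
    (hs : IsPassiveSample μ X ξ pξ) (hI : 0 ≤ I) (hreg : HellingerRegular I v₀ pξ)
    (hQ : ∀ i, μ.map (X i) = Q) (hτ0 : 0 ≤ τ) (hτ : τ ≤ 1 / 2) {w : ℝ → ℝ}
    (hw : MonotoneOn w (Ici 0)) {a t₀ : ℝ} (ha : 0 ≤ a) (ht₀ : 0 ≤ t₀) (hwt : 0 ≤ w t₀)
    (hat : 2 * t₀ ≤ a * s) :
    ENNReal.ofReal (w t₀ * (Real.exp (-(2 * (n * τ))) / 4)) ≤
      minimaxRiskMinimizer μ X ξ Θ F w a := by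
  refine le_iInf₂ fun T hT => ?_
  have hloss : ∀ (θ z : Euc d), s / 2 ≤ ‖z - θ‖ → w t₀ ≤ w (a * ‖z - θ‖) := fun θ z hz =>
    hw ht₀ (mul_nonneg ha (norm_nonneg _)) (by nlinarith)
  rcases hp.le_max_risk hn hs hI hreg hQ hτ0 hτ hT hp.minimizer_sep hwt (hloss _) (hloss _)
    with h | h
  · exact h.trans (le_iSup₂ (f := fun f _ => ∫⁻ ω, ENNReal.ofReal
      (w (a * ‖T (sampleData X ξ f ω) - minimizer Θ f‖)) ∂μ) f hp.mem_left)
  · exact h.trans (le_iSup₂ (f := fun f _ => ∫⁻ ω, ENNReal.ofReal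
      (w (a * ‖T (sampleData X ξ f ω) - minimizer Θ f‖)) ∂μ) g hp.mem_right)

theorem le_minimaxRiskMinValue (hp : IsHypothesisPair Θ F Q I v₀ γ s t τ V S f g) (hn : 1 ≤ n)
    (hs : IsPassiveSample μ X ξ pξ) (hI : 0 ≤ I) (hreg : HellingerRegular I v₀ pξ)
    (hQ : ∀ i, μ.map (X i) = Q) (hτ0 : 0 ≤ τ) (hτ : τ ≤ 1 / 2) {w : ℝ → ℝ}
    (hw : MonotoneOn w (Ici 0)) {a t₀ : ℝ} (ha : 0 ≤ a) (ht₀ : 0 ≤ t₀) (hwt : 0 ≤ w t₀)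
    (hat : 2 * t₀ ≤ a * t) :
    ENNReal.ofReal (w t₀ * (Real.exp (-(2 * (n * τ))) / 4)) ≤
      minimaxRiskMinValue μ X ξ Θ F w a := by
  refine le_iInf₂ fun T hT => ?_
  have hloss : ∀ (θ z : ℝ), t / 2 ≤ ‖z - θ‖ → w t₀ ≤ w (a * ‖z - θ‖) := fun θ z hz =>
    hw ht₀ (mul_nonneg ha (norm_nonneg _)) (by nlinarith)
  rcases hp.le_max_risk hn hs hI hreg hQ hτ0 hτ hT hp.minValue_sep hwt (hloss _) (hloss _)
    with h | h
  · exact h.trans (le_iSup₂ (f := fun f _ => ∫⁻ ω, ENNReal.ofReal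
      (w (a * |T (sampleData X ξ f ω) - minValue Θ f|)) ∂μ) f hp.mem_left)
  · exact h.trans (le_iSup₂ (f := fun f _ => ∫⁻ ω, ENNReal.ofReal
      (w (a * |T (sampleData X ξ f ω) - minValue Θ f|)) ∂μ) g hp.mem_right)

theorem le_minimaxOptimizationRisk (hp : IsHypothesisPair Θ F Q I v₀ γ s t τ V S f g)
    (hn : 1 ≤ n) (hs : IsPassiveSample μ X ξ pξ) (hI : 0 ≤ I) (hreg : HellingerRegular I v₀ pξ)
    (hQ : ∀ i, μ.map (X i) = Q) (hτ0 : 0 ≤ τ) (hτ : τ ≤ 1 / 2) (hγ : 0 ≤ γ) (hs0 : 0 ≤ s) :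
    ((γ / 2 * (s / 2) ^ 2 * (Real.exp (-(2 * (n * τ))) / 4) : ℝ) : EReal) ≤
      minimaxOptimizationRisk μ X ξ Θ F := by
  refine le_iInf₂ fun T hT => ?_
  have hloss : ∀ φ : Euc d → ℝ, (∀ y, minValue Θ φ + γ / 2 * ‖y - minimizer Θ φ‖ ^ 2 ≤ φ y) →
      ∀ z, s / 2 ≤ ‖z - minimizer Θ φ‖ → γ / 2 * (s / 2) ^ 2 ≤ φ z - minValue Θ φ := by
    intro φ hφ z hz
    have h1 : γ / 2 * (s / 2) ^ 2 ≤ γ / 2 * ‖z - minimizer Θ φ‖ ^ 2 := by gcongr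
    linarith [hφ z]
  -- The excess is nonnegative on the whole space, so its negative part does not contribute.
  have hext : ∀ φ : Euc d → ℝ, (∀ y, minValue Θ φ + γ / 2 * ‖y - minimizer Θ φ‖ ^ 2 ≤ φ y) →
      ENNReal.ofReal (γ / 2 * (s / 2) ^ 2 * (Real.exp (-(2 * (n * τ))) / 4)) ≤
        ∫⁻ ω, ENNReal.ofReal (φ (T (sampleData X ξ φ ω)) - minValue Θ φ) ∂μ →
      ((γ / 2 * (s / 2) ^ 2 * (Real.exp (-(2 * (n * τ))) / 4) : ℝ) : EReal) ≤
        extendedExpectation μ (fun ω => φ (T (sampleData X ξ φ ω)) - minValue Θ φ) := by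
    intro φ hφ h
    have hneg : ∫⁻ ω, ENNReal.ofReal (-(φ (T (sampleData X ξ φ ω)) - minValue Θ φ)) ∂μ = 0 := by
      rw [lintegral_congr fun ω => ENNReal.ofReal_of_nonpos ?_, lintegral_zero]
      have h1 := hφ (T (sampleData X ξ φ ω))
      have h2 : 0 ≤ γ / 2 * ‖T (sampleData X ξ φ ω) - minimizer Θ φ‖ ^ 2 := by positivity
      linarith
    rw [extendedExpectation, hneg, EReal.coe_ennreal_zero, sub_zero]
    have h3 := EReal.coe_ennreal_le_coe_ennreal_iff.2 h
    rwa [EReal.coe_ennreal_ofReal, max_eq_left (by positivity)] at h3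
  rcases hp.le_max_risk hn hs hI hreg hQ hτ0 hτ hT hp.minimizer_sep
    (ℓ₀ := fun z => f z - minValue Θ f) (ℓ₁ := fun z => g z - minValue Θ g) (by positivity)
    (hloss f hp.growth_left) (hloss g hp.growth_right) with h | h
  · exact (hext f hp.growth_left h).trans (le_iSup₂ (f := fun f _ => extendedExpectation μ
      (fun ω => f (T (sampleData X ξ f ω)) - minValue Θ f)) f hp.mem_left)
  · exact (hext g hp.growth_right h).trans (le_iSup₂ (f := fun f _ => extendedExpectation μ
      (fun ω => f (T (sampleData X ξ f ω)) - minValue Θ f)) g hp.mem_right)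

end IsHypothesisPair

/-- With bumps of width `h = B / N` the minimizers of the two hypotheses are separated by a
constant multiple of the rate, whether or not the curvature had to be increased. -/
theorem rate_mul_minimizer_separation {β B N α a r t₀ : ℝ} (hB : 0 < B) (hN : 0 < N) (hα : 0 < α)
    (ha : 0 < a) (hr : 0 < r) (h1 : 2 * t₀ ≤ r * B ^ (β - 1)) (h2 : 2 * t₀ ≤ r * B / a) :
    2 * t₀ ≤ max (α * N ^ (β - 1)) N *
      (r * (B / N) ^ (β - 1) / max α (a * (B / N) ^ (β - 2))) := by
  have hh : 0 < B / N := by positivity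
  rcases max_choice α (a * (B / N) ^ (β - 2)) with h | h <;> rw [h]
  · refine h1.trans ?_
    have hNp : 0 < N ^ (β - 1) := Real.rpow_pos_of_pos hN _
    calc r * B ^ (β - 1) = α * N ^ (β - 1) * (r * (B / N) ^ (β - 1) / α) := by
          rw [Real.div_rpow hB.le hN.le]
          field_simp
      _ ≤ _ := mul_le_mul_of_nonneg_right (le_max_left _ _) (by positivity)
  · refine h2.trans ?_
    have hp : 0 < (B / N) ^ (β - 2) := Real.rpow_pos_of_pos hh _
    calc r * B / a = N * (r * (B / N) ^ (β - 1) / (a * (B / N) ^ (β - 2))) := by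
          rw [show β - 1 = (β - 2) + 1 by ring, Real.rpow_add_one hh.ne']
          field_simp
      _ ≤ _ := mul_le_mul_of_nonneg_right (le_max_right _ _) (by positivity)

/-- With bumps of width `h = B / N` the quadratic growth at half the separation of the minimizers
dominates the optimization rate. The two constants in the minimum on the left belong to the two
cases of the maximum. -/
theorem rate_le_optimization_separation {β B N α a r E : ℝ} (hB : 0 < B) (hN : 0 < N) (hα : 0 < α)
    (ha : 0 < a) (hr : 0 < r) (hE : 0 < E) :
    min (r ^ 2 * B ^ (2 * (β - 1)) * E / 32) (r ^ 2 * B ^ 2 * E / (32 * a ^ 2)) *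
        min (α⁻¹ * N ^ (-(2 * (β - 1)))) (α * N ^ (-2 : ℝ)) ≤
      max α (a * (B / N) ^ (β - 2)) / 2 *
        (r * (B / N) ^ (β - 1) / max α (a * (B / N) ^ (β - 2)) / 2) ^ 2 * (E / 4) := by
  have hh : 0 < B / N := by positivity
  have hnn : ∀ p : ℝ, 0 ≤ N ^ p := fun p => Real.rpow_nonneg hN.le p
  have hBp : 0 ≤ B ^ (2 * (β - 1)) := Real.rpow_nonneg hB.le _
  rcases max_cases α (a * (B / N) ^ (β - 2)) with ⟨h, -⟩ | ⟨h, hlt⟩ <;> rw [h]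
  · calc _ ≤ r ^ 2 * B ^ (2 * (β - 1)) * E / 32 * (α⁻¹ * N ^ (-(2 * (β - 1)))) :=
          mul_le_mul (min_le_left _ _) (min_le_left _ _)
            (le_min (mul_nonneg (by positivity) (hnn _)) (mul_nonneg hα.le (hnn _)))
            (by positivity)
      _ = _ := by
          have h1 : ((B / N) ^ (β - 1)) ^ 2 = B ^ (2 * (β - 1)) * N ^ (-(2 * (β - 1))) := by
            rw [← Real.rpow_mul_natCast hh.le, Real.div_rpow hB.le hN.le, Real.rpow_neg hN.le,
              div_eq_mul_inv, Nat.cast_ofNat, mul_comm (β - 1) 2]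
          rw [div_pow, div_pow, mul_pow, h1]
          field_simp
          norm_num
  · have hp : 0 < (B / N) ^ (β - 2) := Real.rpow_pos_of_pos hh _
    calc _ ≤ r ^ 2 * B ^ 2 * E / (32 * a ^ 2) * (α * N ^ (-2 : ℝ)) :=
          mul_le_mul (min_le_right _ _) (min_le_right _ _)
            (le_min (mul_nonneg (by positivity) (hnn _)) (mul_nonneg hα.le (hnn _)))
            (by positivity)
      _ ≤ r ^ 2 * B ^ 2 * E / (32 * a ^ 2) * (a * (B / N) ^ (β - 2) * N ^ (-2 : ℝ)) :=
          mul_le_mul_of_nonneg_left (mul_le_mul_of_nonneg_right hlt.le (hnn _)) (by positivity)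
      _ = _ := by
          rw [show β - 1 = (β - 2) + 1 by ring, Real.rpow_add_one hh.ne', Real.rpow_neg hN.le,
            Real.rpow_two]
          field_simp
          norm_num

/-! ### The minimax lower bounds -/

theorem theorem5 (d : ℕ) (hd : 0 < d)
    (Θ : Set (Euc d)) (hΘ_compact : IsCompact Θ) (hΘ_convex : Convex ℝ Θ)
    (hΘ_int : (interior Θ).Nonempty)
    (β L I v₀ : ℝ) (hβ : 2 ≤ β) (hL : 0 < L) (hI : 0 < I) (hv₀ : 0 < v₀)
    (M₀ κ : ℝ) (hM₀ : 0 < M₀) (hκ₀ : 0 < κ) (hκ₁ : κ < 1) :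
    (∀ w : ℝ → ℝ, MonotoneOn w (Set.Ici 0) → w 0 = 0 → (∃ t : ℝ, 0 ≤ t ∧ w t ≠ 0) →
      ∃ c₁ : ℝ, 0 < c₁ ∧ ∃ c₁' : ℝ, 0 < c₁' ∧ ∃ n₀ : ℕ,
        ((∀ t : ℝ, 0 < t → 0 < w t) → n₀ = 1) ∧
        ∀ (n : ℕ), 1 ≤ n → n₀ ≤ n →
        ∀ (α M : ℝ), 0 < α → (β = 2 → α ≤ 2 * κ * L) →
          M₀ ≤ M → α * (1 + Metric.diam Θ) ^ 2 ≤ M →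
        ∀ (Ω : Type u) [MeasurableSpace Ω] (μ : Measure Ω) [IsProbabilityMeasure μ]
          (X : Fin n → Ω → Euc d) (ξ : Fin n → Ω → ℝ) (pξ : ℝ → ℝ),
          IsPassiveSample μ X ξ pξ → HellingerRegular I v₀ pξ →
          ENNReal.ofReal c₁ ≤
            minimaxRiskMinimizer μ X ξ Θ (regressionClass Θ β α L M) w
              (max (α * (n : ℝ) ^ ((β - 1) / (2 * β + d))) ((n : ℝ) ^ (1 / (2 * β + d)))) ∧
          ENNReal.ofReal c₁' ≤
            minimaxRiskMinValue μ X ξ Θ (regressionClass Θ β α L M) w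
              ((n : ℝ) ^ (β / (2 * β + d)))) ∧
    (∃ c₂ : ℝ, 0 < c₂ ∧
      ∀ (n : ℕ), 1 ≤ n →
      ∀ (α M : ℝ), 0 < α → (β = 2 → α ≤ 2 * κ * L) →
        M₀ ≤ M → α * (1 + Metric.diam Θ) ^ 2 ≤ M →
      ∀ (Ω : Type u) [MeasurableSpace Ω] (μ : Measure Ω) [IsProbabilityMeasure μ]
        (X : Fin n → Ω → Euc d) (ξ : Fin n → Ω → ℝ) (pξ : ℝ → ℝ),
        IsPassiveSample μ X ξ pξ → HellingerRegular I v₀ pξ →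
        ((c₂ * min (α⁻¹ * (n : ℝ) ^ (-(2 * (β - 1)) / (2 * β + d)))
            (α * (n : ℝ) ^ (-2 / (2 * β + d))) : ℝ) : EReal) ≤
          minimaxOptimizationRisk μ X ξ Θ (regressionClass Θ β α L M)) := by
  obtain ⟨r, a, h₀, K, hr, ha, hh₀, hK, hpair⟩ := exists_isHypothesisPair hd
    hΘ_compact.isBounded hΘ_int hβ hL hI hv₀ hM₀ hκ₀ hκ₁
  set p : ℝ := 2 * β + d with hp
  have hp1 : 1 ≤ p := by
    have : (0 : ℝ) ≤ d := Nat.cast_nonneg d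
    linarith
  -- Below the width `h₁` the information per observation is at most `1 / 2`.
  obtain ⟨h₁, hh₁, hh₁₀, hh₁K⟩ : ∃ h₁ : ℝ, 0 < h₁ ∧ h₁ ≤ h₀ ∧
      ∀ h, 0 < h → h ≤ h₁ → K * h ^ p ≤ 1 / 2 := by
    refine ⟨min h₀ (min 1 (1 / (2 * K))), by positivity, min_le_left _ _, fun h hh hle => ?_⟩
    have h1 : h ≤ 1 := hle.trans ((min_le_right _ _).trans (min_le_left _ _))
    have h2 : h ≤ 1 / (2 * K) := hle.trans ((min_le_right _ _).trans (min_le_right _ _))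
    have h3 : h ^ p ≤ h := by
      simpa using Real.rpow_le_rpow_of_exponent_ge hh h1 hp1
    calc K * h ^ p ≤ K * (1 / (2 * K)) := by gcongr; exact h3.trans h2
      _ = 1 / 2 := by field_simp
  have hN : ∀ n : ℕ, 1 ≤ n → 1 ≤ (n : ℝ) ^ (1 / p) := fun n hn =>
    Real.one_le_rpow (by exact_mod_cast hn) (by positivity)
  have hNpow : ∀ (n : ℕ) (q : ℝ), (n : ℝ) ^ (q / p) = ((n : ℝ) ^ (1 / p)) ^ q := fun n q => by
    rw [← Real.rpow_mul (Nat.cast_nonneg n)]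
    congr 1
    ring
  have hinfo : ∀ (n : ℕ), 1 ≤ n → ∀ B : ℝ, 0 < B →
      n * (K * (B / (n : ℝ) ^ (1 / p)) ^ p) = K * B ^ p := fun n hn B hB => by
    have hn0 : (0 : ℝ) < n := by exact_mod_cast hn
    rw [Real.div_rpow hB.le (by positivity), ← hNpow, div_self (by positivity), Real.rpow_one]
    field_simp
  have hdesign : ∀ {n : ℕ}, 1 ≤ n → ∀ {Ω : Type u} [MeasurableSpace Ω] {μ : Measure Ω}
      [IsProbabilityMeasure μ] {X : Fin n → Ω → Euc d} {ξ : Fin n → Ω → ℝ} {pξ : ℝ → ℝ},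
      IsPassiveSample μ X ξ pξ → ∃ Q : Measure (Euc d), IsProbabilityMeasure Q ∧
        ∀ i, μ.map (X i) = Q := by
    intro n hn Ω _ μ _ X ξ pξ hs
    obtain ⟨q, -, -, -, hq⟩ := hs.design_density
    exact ⟨_, hq ⟨0, hn⟩ ▸ Measure.isProbabilityMeasure_map (hs.measurable_design _).aemeasurable,
      hq⟩
  refine ⟨fun w hw hw0 hwne => ?_, ?_⟩
  · -- The bumps have width `B / N`, where `N = n ^ (1 / (2 β + d))`.
    obtain ⟨B, t₀, n₀, hB, ht₀, hwt, hB1, hB2, hB3, hn₀, hn₀B⟩ : ∃ B t₀ : ℝ, ∃ n₀ : ℕ, 0 < B ∧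
        0 ≤ t₀ ∧ 0 < w t₀ ∧ 2 * t₀ ≤ r * B ^ (β - 1) ∧ 2 * t₀ ≤ r * B / a ∧ 2 * t₀ ≤ r * B ^ β ∧
        ((∀ t : ℝ, 0 < t → 0 < w t) → n₀ = 1) ∧
        ∀ n : ℕ, 1 ≤ n → n₀ ≤ n → B ≤ h₁ * (n : ℝ) ^ (1 / p) := by
      by_cases hwpos : ∀ t : ℝ, 0 < t → 0 < w t
      · -- Any separation will do, so the width may be small enough for every `n`.
        obtain ⟨t₀, ht₀, ht1, ht2, ht3⟩ : ∃ t₀ : ℝ, 0 < t₀ ∧ 2 * t₀ ≤ r * h₁ ^ (β - 1) ∧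
            2 * t₀ ≤ r * h₁ / a ∧ 2 * t₀ ≤ r * h₁ ^ β := by
          refine ⟨min (r * h₁ ^ (β - 1)) (min (r * h₁ / a) (r * h₁ ^ β)) / 2, by positivity,
            ?_, ?_, ?_⟩ <;> rw [mul_div_cancel₀ _ two_ne_zero]
          · exact min_le_left _ _
          · exact (min_le_right _ _).trans (min_le_left _ _)
          · exact (min_le_right _ _).trans (min_le_right _ _)
        exact ⟨h₁, t₀, 1, hh₁, ht₀.le, hwpos t₀ ht₀, ht1, ht2, ht3, fun _ => rfl,
          fun n hn _ => le_mul_of_one_le_right hh₁.le (hN n hn)⟩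
      · -- The separation has to exceed a threshold of `w`, which takes wide bumps and large `n`.
        obtain ⟨t₀, ht₀, hwt⟩ := hwne
        have hwt' : 0 < w t₀ :=
          lt_of_le_of_ne (hw0 ▸ hw self_mem_Ici ht₀ ht₀) hwt.symm
        obtain ⟨B, hB1, hB2, hB3⟩ : ∃ B : ℝ, 1 ≤ B ∧ 2 * t₀ ≤ r * B ∧ 2 * t₀ ≤ r * B / a := by
          refine ⟨max 1 (max (2 * t₀ / r) (2 * t₀ * a / r)), le_max_left _ _, ?_, ?_⟩
          · rw [← div_le_iff₀' hr]
            exact (le_max_left _ _).trans (le_max_right _ _)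
          · rw [le_div_iff₀ ha, ← div_le_iff₀' hr]
            exact (le_max_right _ _).trans (le_max_right _ _)
        have hBq : ∀ q : ℝ, 1 ≤ q → 2 * t₀ ≤ r * B ^ q := fun q hq => by
          refine hB2.trans (mul_le_mul_of_nonneg_left ?_ hr.le)
          simpa using Real.rpow_le_rpow_of_exponent_le hB1 hq
        obtain ⟨n₀, hn₀⟩ := exists_nat_ge ((B / h₁) ^ p)
        refine ⟨B, t₀, n₀, by linarith, ht₀, hwt', hBq _ (by linarith), hB3, hBq _ (by linarith),
          fun h => absurd h hwpos, fun n _ hn => ?_⟩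
        rw [← div_le_iff₀' hh₁, ← Real.rpow_le_rpow_iff (by positivity) (by positivity)
          (by linarith : 0 < p), ← hNpow, div_self (by positivity), Real.rpow_one]
        exact hn₀.trans (by exact_mod_cast hn)
    refine ⟨w t₀ * (Real.exp (-(2 * (K * B ^ p))) / 4), by positivity,
      w t₀ * (Real.exp (-(2 * (K * B ^ p))) / 4), by positivity, n₀, hn₀, ?_⟩
    intro n hn hnn α M hα hα2 hM hαM Ω _ μ _ X ξ pξ hs hreg
    obtain ⟨Q, _, hQ⟩ := hdesign hn hs
    have hN0 : 0 < (n : ℝ) ^ (1 / p) := one_pos.trans_le (hN n hn)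
    have hh : 0 < B / (n : ℝ) ^ (1 / p) := by positivity
    have hhle : B / (n : ℝ) ^ (1 / p) ≤ h₁ := (div_le_iff₀ hN0).2 (hn₀B n hn hnn)
    obtain ⟨V, S, f, g, hfg⟩ := hpair _ α M hh (hhle.trans hh₁₀) hα hα2 hM hαM Q
    rw [← hinfo n hn B hB]
    refine ⟨hfg.le_minimaxRiskMinimizer hn hs hI.le hreg hQ (by positivity) (hh₁K _ hh hhle) hw
      (by positivity) ht₀ hwt.le ?_, hfg.le_minimaxRiskMinValue hn hs hI.le hreg hQ
      (by positivity) (hh₁K _ hh hhle) hw (by positivity) ht₀ hwt.le ?_⟩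
    · rw [hNpow n (β - 1)]
      exact rate_mul_minimizer_separation hB hN0 hα ha hr hB1 hB2
    · rw [hNpow n β, Real.div_rpow hB.le hN0.le]
      refine hB3.trans (le_of_eq ?_)
      have : 0 < ((n : ℝ) ^ (1 / p)) ^ β := Real.rpow_pos_of_pos hN0 _
      field_simp
  · have hE := Real.exp_pos (-(2 * (K * h₁ ^ p)))
    refine ⟨min (r ^ 2 * h₁ ^ (2 * (β - 1)) * Real.exp (-(2 * (K * h₁ ^ p))) / 32)
      (r ^ 2 * h₁ ^ 2 * Real.exp (-(2 * (K * h₁ ^ p))) / (32 * a ^ 2)), by positivity, ?_⟩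
    intro n hn α M hα hα2 hM hαM Ω _ μ _ X ξ pξ hs hreg
    obtain ⟨Q, _, hQ⟩ := hdesign hn hs
    have hN0 : 0 < (n : ℝ) ^ (1 / p) := one_pos.trans_le (hN n hn)
    have hh : 0 < h₁ / (n : ℝ) ^ (1 / p) := by positivity
    have hhle : h₁ / (n : ℝ) ^ (1 / p) ≤ h₁ := div_le_self hh₁.le (hN n hn)
    obtain ⟨V, S, f, g, hfg⟩ := hpair _ α M hh (hhle.trans hh₁₀) hα hα2 hM hαM Q
    refine le_trans ?_ (hfg.le_minimaxOptimizationRisk hn hs hI.le hreg hQ (by positivity)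
      (hh₁K _ hh hhle) (by positivity) (by positivity))
    rw [hinfo n hn h₁ hh₁, hNpow n (-(2 * (β - 1))), hNpow n (-2)]
    exact EReal.coe_le_coe_iff.2 (rate_le_optimization_separation hh₁ hN0 hα ha hr hE)
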